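/- Let $G$ be a directed acyclic graph on $V=\{1,\dots,p\}$ with edge set $E$, where $(i,j)\in E$ implies $i<j$. For $a=(a_{ij})_{(i,j)\in E}$ in $\Omega=[-1,1]^E$, let $A$ be the $p\times p$ matrix with entry $a_{ij}$ in position $(i,j)$ for $(i,j)\in E$ and $0$ elsewhere, and let $K=(A-I)(A-I)^T$, the concentration matrix of the Gaussian model $X=A^TX+\epsilon$, $\epsilon\sim\mathcal N(0,I)$. For $S\subset V$ and distinct $i,j\in V\setminus S$, put $R=V\setminus(S\cup\{i,j\})$, $iR=\{i\}\cup R$, $jR=\{j\}\cup R$, and let the partial correlation be (up to sign) $$\operatorname{corr}(i,j|S)=\frac{\det K_{iR,jR}}{\sqrt{\det K_{iR,iR}\cdot\det K_{jR,jR}}}.$$ The distribution with parameter $a$ is $\lambda$-strong-faithful to $G$ if for all such $i,j,S$ one has $|\operatorname{corr}(i,j|S)|\le\lambda$ if and only if $i$ and $j$ are d-separated given $S$ in $G$ (that is, no path from $i$ to $j$ in the underlying undirected graph is such that each of its non-colliders is not in $S$ and each of its colliders is in $S$ or is an ancestor of a node in $S$). Let $\varphi:\Omega\to\mathbb R$ be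 a strictly positive real-analytic probability density, and let $V_G(\lambda)=\int\varphi(a)\,da$ over the set of those $a\in\Omega$ whose distribution is not $\lambda$-strong-faithful to $G$. (i) Let $p\ge 2$ and let $G=\mathrm{Chain}_p$, with edges $(k,k+1)$, $1\le k\le p-1$. Then there is a constant $C_{\rm chain}>0$, depending on $p$ and $\varphi$, such that $$V_G(\lambda)\approx C_{\rm chain}\cdot\lambda(-\ln\lambda)^{p-2}.$$ (ii) Let $p\ge 3$ and let $G=\mathrm{Star}_p$, with edges $(1,j)$, $2\le j\le p$. Then there is a constant $C_{\rm star}>0$, depending on $p$ and $\varphi$, such that $$V_G(\lambda)\approx C_{\rm star}\cdot\lambda(-\ln\lambda).$$ Here $V(\lambda)\approx g(\lambda)$ means $\lim_{\lambda\to0^+}\,(V(\lambda)-g(\lambda))/g(\lambda)=0$. -/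

import Mathlib

open MeasureTheory Filter Topology Asymptotics

/-- A directed acyclic graph on the nodes `0, …, p - 1`, topologically ordered:
every edge `(i, j)`, i.e. `i → j`, satisfies `i < j`. -/
structure OrderedDAG (p : ℕ) where
  edges : Finset (Fin p × Fin p)
  lt_of_mem : ∀ e ∈ edges, e.1 < e.2

namespace OrderedDAG

variable {p : ℕ} (G : OrderedDAG p)

/-- A choice of real edge weights `a_{ij}`, one for each edge. -/
abbrev Param : Type := ↥G.edges → ℝ

/-- The undirected graph obtained by removing the arrowheads. -/
def skeleton : SimpleGraph (Fin p) := SimpleGraph.fromRel (fun i j => (i, j) ∈ G.edges)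

/-- `i` is an ancestor of `j`: there is a directed path `i → ⋯ → j`. -/
def IsAncestor (i j : Fin p) : Prop := Relation.TransGen (fun k l => (k, l) ∈ G.edges) i j

/-- The `n`-th vertex of the walk `P` is a collider on `P`. -/
def IsColliderAt {i j : Fin p} (P : G.skeleton.Walk i j) (n : ℕ) : Prop :=
  0 < n ∧ n < P.length ∧
    (P.getVert (n - 1), P.getVert n) ∈ G.edges ∧ (P.getVert (n + 1), P.getVert n) ∈ G.edges

/-- The undirected path `P` d-connects its end points given `S`: every non-collider on `P` is not
in `S`, and every collider on `P` is in `S` or an ancestor of a node in `S`. -/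
def DConnects {i j : Fin p} (P : G.skeleton.Walk i j) (S : Finset (Fin p)) : Prop :=
  P.IsPath ∧ ∀ n ≤ P.length,
    (¬ G.IsColliderAt P n → P.getVert n ∉ S) ∧
    (G.IsColliderAt P n → P.getVert n ∈ S ∨ ∃ s ∈ S, G.IsAncestor (P.getVert n) s)

/-- `i` and `j` are d-separated given `S`: no path from `i` to `j` d-connects them given `S`. -/
def DSeparated (i j : Fin p) (S : Finset (Fin p)) : Prop :=
  ¬ ∃ P : G.skeleton.Walk i j, G.DConnects P S

/-- The weighted adjacency matrix `A_G`. -/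
def adj (a : G.Param) : Matrix (Fin p) (Fin p) ℝ :=
  Matrix.of fun i j => if h : (i, j) ∈ G.edges then a ⟨(i, j), h⟩ else 0

/-- The concentration matrix `K = (A_G - I)(A_G - I)ᵀ` of the Gaussian structural equation model
`X = A_Gᵀ X + ε`, `ε ∼ N(0, I)`. -/
def conc (a : G.Param) : Matrix (Fin p) (Fin p) ℝ :=
  (G.adj a - 1) * (G.adj a - 1).transpose

/-- The minor `det K_{iR,jR}`: the first row is `i`, the first column is `j`, and the other rows and
columns are those in `R`, in the same order. -/
def minor (K : Matrix (Fin p) (Fin p) ℝ) (i j : Fin p) (R : Finset (Fin p)) : ℝ :=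
  (K.submatrix (Sum.elim (fun _ : Unit => i) (fun r : ↥R => (r : Fin p)))
    (Sum.elim (fun _ : Unit => j) (fun r : ↥R => (r : Fin p)))).det

/-- The partial correlation `corr(i, j | S)`, up to sign, as a function of the edge weights:
`det K_{iR,jR} / √(det K_{iR,iR} · det K_{jR,jR})` with `R = V \ (S ∪ {i, j})`. -/
noncomputable def corr (a : G.Param) (i j : Fin p) (S : Finset (Fin p)) : ℝ :=
  minor (G.conc a) i j (Finset.univ \ (S ∪ {i, j})) /
    √(minor (G.conc a) i i (Finset.univ \ (S ∪ {i, j})) *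
      minor (G.conc a) j j (Finset.univ \ (S ∪ {i, j})))

/-- The Gaussian distribution with edge weights `a` is `t`-strong-faithful to `G`. -/
def StrongFaithful (t : ℝ) (a : G.Param) : Prop :=
  ∀ (S : Finset (Fin p)) (i j : Fin p), i ∉ S → j ∉ S → i ≠ j →
    (|G.corr a i j S| ≤ t ↔ G.DSeparated i j S)

/-- The parameter space `Ω = [-1, 1]^E`. -/
def cube : Set G.Param := Set.Icc (-1) 1

/-- `φ` is a strictly positive real-analytic probability density on `Ω = [-1, 1]^E`. -/
structure IsPrior (φ : G.Param → ℝ) : Prop where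
  analytic : AnalyticOn ℝ φ G.cube
  pos : ∀ a ∈ G.cube, 0 < φ a
  integral_eq_one : ∫ a in G.cube, φ a = 1

/-- `V_G(t)`: the volume, with respect to the density `φ`, of the set of parameters in `Ω` whose
distributions are not `t`-strong-faithful to `G`. -/
noncomputable def unfaithfulVolume (φ : G.Param → ℝ) (t : ℝ) : ℝ :=
  ∫ a in {a | a ∈ G.cube ∧ ¬ G.StrongFaithful t a}, φ a

end OrderedDAG

/-- The chain `0 → 1 → ⋯ → p - 1`. -/
def chainDAG (p : ℕ) : OrderedDAG p where
  edges := Finset.univ.filter fun e => e.1.val + 1 = e.2.val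
  lt_of_mem := by
    intro e he
    have h := (Finset.mem_filter.mp he).2
    exact Fin.lt_def.mpr (by omega)

/-- The star with edges `0 → j` for all `j ≠ 0`. -/
def starDAG (p : ℕ) : OrderedDAG p where
  edges := Finset.univ.filter fun e => e.1.val = 0 ∧ 0 < e.2.val
  lt_of_mem := by
    intro e he
    have h := (Finset.mem_filter.mp he).2
    exact Fin.lt_def.mpr (by omega)

/-!
Both graphs are forests: no node has two parents. So a path has no colliders, two nodes are
d-separated by `S` if and only if every walk between them meets `S`, and the concentration matrix
has no entries outside the diagonal and the edges. If `S` separates `i` and `j`, the minor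
`det K_{iR,jR}` vanishes (`minor_eq_zero_of_separated`). If it does not, then the path
`i = v 0, …, v m = j` runs inside `R`; matching the row `v k` with the column `v (k + 1)` makes
the matrix block triangular, and the minor is, up to sign, the product of the edge weights on the
path times principal minors of `K`, which are positive (`exists_abs_minor_eq_prod_mul`). Hence
`|corr (i, j | S)|` is the product of the weights on the path times a positive continuous
function, and the unfaithful parameters are a finite union of sets
`{∏_{e ∈ J} |a e| ≤ t * w a}` with `w` continuous and positive.

The rest is about the volume of such sets. By induction on `m`, the set `{∏ |x i| ≤ s}` fills,
for `0 < s < 1`, the share `s * ∑_{k < m} (-log s)^k / k!` of the cube `[-1, 1]^m`, which is of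
the order `s * (-log s)^(m-1)` as `s → 0`. Most of this volume is near the origin: if one
coordinate stays away from `0`, the product of the others is small, which is rarer by a factor
`log`. So for a weight `w` and a density `φ` only `w 0` and `φ 0` matter
(`tendsto_setIntegral_prodLeSet_univ`). When only the coordinates in `J` are constrained, this
holds for each value of the other coordinates, over which one integrates by dominated convergence
(`exists_tendsto_setIntegral_prodLeSet`). In a finite union only the largest sets `J` count, and
two different ones overlap negligibly (`tendsto_volume_inter_prodLeBox`), so the constants add up
to a positive one. The largest number of edges on a path is `p - 1` for the chain and `2` for the
star.
-/

/-! ### Minors of a matrix whose pattern is a tree -/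

namespace OrderedDAG

lemma minor_comm {p : ℕ} {K : Matrix (Fin p) (Fin p) ℝ} (hK : K.transpose = K) (i j : Fin p)
    (R : Finset (Fin p)) : minor K i j R = minor K j i R := by
  unfold minor
  rw [← Matrix.det_transpose, Matrix.transpose_submatrix, hK]

lemma continuous_minor {p : ℕ} {X : Type*} [TopologicalSpace X] {K : X → Matrix (Fin p) (Fin p) ℝ}
    (hK : Continuous K) (i j : Fin p) (R : Finset (Fin p)) :
    Continuous fun a => minor (K a) i j R :=
  (hK.matrix_submatrix _ _).matrix_det

lemma injective_sumElim_coe {V : Type*} {i : V} {R : Finset V} (hi : i ∉ R) :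
    Function.Injective (Sum.elim (fun _ : Unit => i) (fun r : ↥R => (r : V))) :=
  Function.Injective.sumElim (Function.injective_of_subsingleton _) Subtype.val_injective
    fun _ r h => hi (h ▸ r.2)

lemma minor_self_pos {p : ℕ} {K : Matrix (Fin p) (Fin p) ℝ} (hK : K.PosDef) {i : Fin p}
    {R : Finset (Fin p)} (hi : i ∉ R) : 0 < minor K i i R :=
  (hK.submatrix (injective_sumElim_coe hi)).det_pos

/-- If the entries of `K` vanish between the two sides of a partition that separates `i` from `j`,
then the minor vanishes: in the Leibniz expansion, the rows on the side of `i` outnumber the columns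
on that side, so every permutation uses an entry that is zero. -/
lemma minor_eq_zero_of_separated {p : ℕ} (K : Matrix (Fin p) (Fin p) ℝ) {i j : Fin p}
    {R : Finset (Fin p)} (side : Fin p → Prop) (hi : side i) (hj : ¬ side j)
    (hK : ∀ x ∈ insert i R, ∀ y ∈ insert j R, side x → ¬ side y → K x y = 0) :
    minor K i j R = 0 := by
  classical
  unfold minor
  rw [Matrix.det_apply]
  refine Finset.sum_eq_zero fun σ _ => ?_
  set row : Unit ⊕ R → Fin p := Sum.elim (fun _ => i) (fun r : R => (r : Fin p)) with hrow
  set col : Unit ⊕ R → Fin p := Sum.elim (fun _ => j) (fun r : R => (r : Fin p)) with hcol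
  -- `row` and `col` agree on `R`, and `i` is one more node on the side of the rows
  obtain ⟨z, hz, hz'⟩ : ∃ z, side (row (σ z)) ∧ ¬ side (col z) := by
    by_contra! hcon
    have hlt : (Finset.univ.filter fun z => side (col z)).card <
        (Finset.univ.filter fun z => side (row z)).card := by
      refine Finset.card_lt_card (Finset.ssubset_iff_of_subset ?_ |>.mpr ⟨Sum.inl (), ?_, ?_⟩)
      · rintro (_ | r) hz
        · exact absurd (Finset.mem_filter.mp hz).2 hj
        · exact Finset.mem_filter.mpr ⟨Finset.mem_univ _, (Finset.mem_filter.mp hz).2⟩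
      · exact Finset.mem_filter.mpr ⟨Finset.mem_univ _, hi⟩
      · exact fun hz => hj (Finset.mem_filter.mp hz).2
    refine absurd (Finset.card_le_card_of_injOn σ.symm ?_ σ.symm.injective.injOn) hlt.not_ge
    intro z hz
    have hz := (Finset.mem_filter.mp hz).2
    exact Finset.mem_coe.mpr (Finset.mem_filter.mpr
      ⟨Finset.mem_univ _, hcon _ (by simpa using hz)⟩)
  have hmem : ∀ (l : Fin p) (z : Unit ⊕ R),
      Sum.elim (fun _ => l) (fun r : R => (r : Fin p)) z ∈ insert l R := by
    rintro l (_ | r)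
    · exact Finset.mem_insert_self _ _
    · exact Finset.mem_insert_of_mem r.2
  have h0 : K (row (σ z)) (col z) = 0 := hK _ (hmem i _) _ (hmem j _) hz hz'
  rw [Finset.prod_eq_zero (Finset.mem_univ z) (by simpa using h0), smul_zero]

/-- Factorization of a minor along a path. Let `v 0 = i, …, v m = j` be a path whose interior lies
in `R`, and suppose that the remaining nodes hang on the path: `b x` is the index of the path node
at which `x` is attached, and `K` has no other entries than those between nodes attached at the same
place and those along the path. Matching the row `v k` with the column `v (k + 1)` makes the
matrix block triangular, so that the minor is, up to sign, the product of the entries along the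
path times principal minors of `K`. -/
lemma exists_abs_minor_eq_prod_mul {p : ℕ} {X : Type*} [TopologicalSpace X]
    {K : X → Matrix (Fin p) (Fin p) ℝ} (hK : Continuous K) (hpos : ∀ a, (K a).PosDef)
    {i j : Fin p} {R : Finset (Fin p)} (hiR : i ∉ R) (hjR : j ∉ R)
    {m : ℕ} (hm : 0 < m) (v : ℕ → Fin p) (b : Fin p → ℕ) (hv0 : v 0 = i) (hvm : v m = j)
    (hvR : ∀ k, 0 < k → k < m → v k ∈ R) (hbv : ∀ k ≤ m, b (v k) = k) (hb : ∀ x, b x ≤ m)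
    (hsp : ∀ a x y, K a x y ≠ 0 → b x = b y ∨
      ∃ k < m, (x = v k ∧ y = v (k + 1)) ∨ (x = v (k + 1) ∧ y = v k)) :
    ∃ h : X → ℝ, Continuous h ∧ (∀ a, 0 < h a) ∧
      ∀ a, |minor (K a) i j R| = (∏ k ∈ Finset.range m, |K a (v k) (v (k + 1))|) * h a := by
  classical
  set row : Unit ⊕ R → Fin p := Sum.elim (fun _ => i) (fun r : R => (r : Fin p)) with hrow
  set col : Unit ⊕ R → Fin p := Sum.elim (fun _ => j) (fun r : R => (r : Fin p)) with hcol
  -- the column matched with the row of a node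
  let nxt : Fin p → Fin p := fun y => if y = v (b y) then v (b y + 1) else y
  -- the blocks: level `2 * k + 1` is the single path node `v k`, level `2 * k` what hangs on it
  let lev : Fin p → ℕ := fun y => if y = v (b y) then 2 * b y + 1 else 2 * b y
  have rowInj : Function.Injective row := injective_sumElim_coe hiR
  -- a row that lies on the path is not its last node
  have rowlt : ∀ x, row x = v (b (row x)) → b (row x) < m := by
    intro x hx
    refine lt_of_le_of_ne (hb _) fun h => ?_
    rw [h, hvm] at hx
    rcases x with _ | ⟨x, hxR⟩
    · have h0 : b i = 0 := by rw [← hv0]; exact hbv 0 (Nat.zero_le _)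
      simp only [hrow, Sum.elim_inl] at hx h
      omega
    · simp only [hrow, Sum.elim_inr] at hx
      exact hjR (hx ▸ hxR)
  have hcolr : ∀ y, y = j ∨ y ∈ R → ∃ z, col z = y := by
    rintro y (rfl | hy)
    · exact ⟨Sum.inl (), rfl⟩
    · exact ⟨Sum.inr ⟨y, hy⟩, rfl⟩
  have hσ : ∀ x, ∃ z, col z = nxt (row x) := by
    intro x
    apply hcolr
    by_cases h : row x = v (b (row x))
    · have hlt := rowlt x h
      simp only [nxt, if_pos h]
      rcases (Nat.succ_le_of_lt hlt).eq_or_lt with h1 | h1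
      · left; rw [← hvm, ← h1]
      · right; exact hvR _ (Nat.succ_pos _) h1
    · right
      simp only [nxt, if_neg h]
      rcases x with _ | ⟨x, hxR⟩
      · exfalso; apply h
        simp only [hrow, Sum.elim_inl]
        rw [← hv0, hbv 0 (Nat.zero_le _)]
      · exact hxR
  choose σ₀ hσ₀ using hσ
  have nxtInj : ∀ x y, nxt (row x) = nxt (row y) → x = y := by
    intro x y hxy
    apply rowInj
    by_cases h : row x = v (b (row x)) <;> by_cases h' : row y = v (b (row y))
    · simp only [nxt, if_pos h, if_pos h'] at hxy
      have h1 := congrArg b hxy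
      rw [hbv _ (rowlt x h), hbv _ (rowlt y h')] at h1
      rw [h, h']; congr 1; omega
    · simp only [nxt, if_pos h, if_neg h'] at hxy
      exact absurd (by rw [← hxy, hbv _ (rowlt x h)]) h'
    · simp only [nxt, if_neg h, if_pos h'] at hxy
      exact absurd (by rw [hxy, hbv _ (rowlt y h')]) h
    · simpa only [nxt, if_neg h, if_neg h'] using hxy
  have σInj : Function.Injective σ₀ := fun x y h => nxtInj x y (by rw [← hσ₀, ← hσ₀, h])
  let σ : Equiv.Perm (Unit ⊕ R) := Equiv.ofBijective σ₀ (Finite.injective_iff_bijective.mp σInj)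
  let T : X → Matrix (Unit ⊕ R) (Unit ⊕ R) ℝ := fun a =>
    Matrix.of fun x y => K a (row y) (nxt (row x))
  have hT : ∀ a, |minor (K a) i j R| = |(T a).det| := by
    intro a
    have h1 : T a = (((K a).submatrix row col).submatrix id σ).transpose := by
      ext x y
      simp [T, σ, hσ₀]
    rw [h1, Matrix.det_transpose, Matrix.det_permute']
    rcases Int.units_eq_one_or (Equiv.Perm.sign σ) with h | h <;> simp [h, minor, hrow, hcol]
  have htri : ∀ a, (T a).BlockTriangular (lev ∘ row) := by
    intro a x y hlt
    by_contra hne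
    simp only [T, Matrix.of_apply] at hne
    simp only [Function.comp] at hlt
    have hsp' := hsp a _ _ hne
    by_cases h : row x = v (b (row x))
    · have hxm := rowlt x h
      simp only [nxt, if_pos h] at hsp'
      simp only [lev, if_pos h] at hlt
      rw [hbv _ hxm] at hsp'
      rcases hsp' with h1 | ⟨k, hk, ⟨h1, h2⟩ | ⟨h1, h2⟩⟩
      · split_ifs at hlt <;> omega
      · have h3 := congrArg b h2
        rw [hbv _ hxm, hbv _ hk] at h3
        have h4 : b (row y) = k := by rw [h1, hbv k hk.le]
        rw [if_pos (by rw [h4]; exact h1)] at hlt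
        omega
      · have h3 := congrArg b h2
        rw [hbv _ hxm, hbv _ hk.le] at h3
        have h4 : b (row y) = k + 1 := by rw [h1, hbv _ hk]
        split_ifs at hlt <;> omega
    · simp only [nxt, if_neg h] at hsp'
      simp only [lev, if_neg h] at hlt
      rcases hsp' with h1 | ⟨k, hk, ⟨h1, h2⟩ | ⟨h1, h2⟩⟩
      · split_ifs at hlt <;> omega
      · exact h (by rw [h2, hbv _ hk])
      · exact h (by rw [h2, hbv _ hk.le])
  have hdet : ∀ a, (T a).det = (∏ k ∈ Finset.range m, K a (v k) (v (k + 1))) *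
      ∏ k ∈ Finset.range (m + 1), ((T a).toSquareBlock (lev ∘ row) (2 * k)).det := by
    intro a
    have h1 : (T a).det =
        ∏ k ∈ Finset.range (2 * (m + 1)), ((T a).toSquareBlock (lev ∘ row) k).det := by
      refine (htri a).det.trans (Finset.prod_subset ?_ fun k _ hk => ?_)
      · intro k hk
        obtain ⟨x, -, rfl⟩ := Finset.mem_image.mp hk
        have := hb (row x)
        simp only [Function.comp, lev, Finset.mem_range]
        split_ifs <;> omega
      · have : IsEmpty { x // (lev ∘ row) x = k } :=
          ⟨fun x => hk (Finset.mem_image.2 ⟨x, Finset.mem_univ _, x.2⟩)⟩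
        exact Matrix.det_isEmpty
    have h2 : ∀ (f : ℕ → ℝ) n, ∏ k ∈ Finset.range (2 * n), f k =
        (∏ k ∈ Finset.range n, f (2 * k + 1)) * ∏ k ∈ Finset.range n, f (2 * k) := by
      intro f n
      induction n with
      | zero => simp
      | succ n ih =>
        rw [mul_add, mul_one, Finset.prod_range_succ, Finset.prod_range_succ, ih,
          Finset.prod_range_succ _ n, Finset.prod_range_succ _ n]
        ring
    rw [h1, h2]
    congr 1
    rw [Finset.prod_range_succ]
    have hodd : ∀ k (x : { x // (lev ∘ row) x = 2 * k + 1 }), row x = v k ∧ b (row x) = k := by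
      rintro k ⟨x, hx⟩
      simp only [Function.comp, lev] at hx
      split_ifs at hx with h
      · have : b (row x) = k := by omega
        exact ⟨h.trans (congrArg v this), this⟩
      · omega
    -- the last path node is a column but not a row
    have hlast : IsEmpty { x // (lev ∘ row) x = 2 * m + 1 } := by
      refine ⟨fun x => ?_⟩
      have h := hodd m x
      have := rowlt x (by rw [h.2]; exact h.1)
      omega
    rw [Matrix.det_isEmpty (A := (T a).toSquareBlock (lev ∘ row) (2 * m + 1)), mul_one]
    refine Finset.prod_congr rfl fun k hk => ?_
    have hk := Finset.mem_range.mp hk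
    have hex : ∃ x, row x = v k := by
      rcases Nat.eq_zero_or_pos k with rfl | h0
      · exact ⟨Sum.inl (), hv0.symm⟩
      · exact ⟨Sum.inr ⟨v k, hvR k h0 hk⟩, rfl⟩
    obtain ⟨x, hx⟩ := hex
    have hbx : b (row x) = k := by rw [hx, hbv k hk.le]
    let u : Unique { x // (lev ∘ row) x = 2 * k + 1 } :=
      { default := ⟨x, by simp [lev, hx, hbv k hk.le]⟩
        uniq := fun y => Subtype.ext (rowInj (by rw [(hodd k y).1, hx])) }
    rw [Matrix.det_unique]
    change K a (row x) (nxt (row x)) = _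
    simp [nxt, hx, hbv k hk.le]
  have hblock : ∀ a k, (T a).toSquareBlock (lev ∘ row) (2 * k) =
      ((K a).submatrix (fun x : { x // (lev ∘ row) x = 2 * k } => row x)
        (fun x : { x // (lev ∘ row) x = 2 * k } => row x)).transpose := by
    intro a k
    ext x y
    have : nxt (row x) = row x := by
      have hx := x.2
      simp only [Function.comp, lev] at hx
      split_ifs at hx with h
      · omega
      · simp [nxt, if_neg h]
    simp [T, Matrix.toSquareBlock, Matrix.toSquareBlockProp, this]
  refine ⟨fun a => ∏ k ∈ Finset.range (m + 1), ((K a).submatrix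
      (fun x : { x // (lev ∘ row) x = 2 * k } => row x)
      (fun x : { x // (lev ∘ row) x = 2 * k } => row x)).det, ?_, fun a => ?_, fun a => ?_⟩
  · exact continuous_finsetProd _ fun k _ => (hK.matrix_submatrix _ _).matrix_det
  · exact Finset.prod_pos fun k _ =>
      ((hpos a).submatrix (rowInj.comp Subtype.val_injective)).det_pos
  · rw [hT, hdet, abs_mul, Finset.abs_prod]
    congr 1
    simp_rw [hblock, Matrix.det_transpose]
    exact abs_of_pos (Finset.prod_pos fun k _ =>
      ((hpos a).submatrix (rowInj.comp Subtype.val_injective)).det_pos)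

/-! ### The concentration matrix -/

lemma continuous_adj {p : ℕ} (G : OrderedDAG p) : Continuous G.adj := by
  refine continuous_matrix fun i j => ?_
  by_cases h : (i, j) ∈ G.edges
  · simpa [adj, h] using continuous_apply _
  · simpa [adj, h] using continuous_const

lemma continuous_conc {p : ℕ} (G : OrderedDAG p) : Continuous G.conc := by
  have h : Continuous fun a => G.adj a - 1 := G.continuous_adj.sub continuous_const
  exact h.matrix_mul h.matrix_transpose

/-- `A - I` is upper triangular with diagonal `-1`, hence invertible. -/
lemma posDef_conc {p : ℕ} (G : OrderedDAG p) (a : G.Param) : (G.conc a).PosDef := by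
  have hdiag : ∀ i, (G.adj a - 1) i i = -1 := by
    intro i
    have : (i, i) ∉ G.edges := fun h => lt_irrefl _ (G.lt_of_mem _ h)
    simp [adj, this]
  have hdet : IsUnit (G.adj a - 1).det := by
    rw [Matrix.det_of_isUpperTriangular]
    · simp [hdiag]
    · intro i j hij
      have : (i, j) ∉ G.edges := fun h => lt_asymm hij (G.lt_of_mem _ h)
      have hne : i ≠ j := (ne_of_lt hij).symm
      simp [adj, this, hne]
  have := Matrix.PosDef.mul_conjTranspose_self (G.adj a - 1)
    (Matrix.vecMul_injective_iff_isUnit.mpr ((Matrix.isUnit_iff_isUnit_det _).mpr hdet))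
  rwa [Matrix.conjTranspose_eq_transpose_of_trivial] at this

lemma transpose_conc {p : ℕ} (G : OrderedDAG p) (a : G.Param) :
    (G.conc a).transpose = G.conc a := by
  simp [conc, Matrix.transpose_mul]

/-- When no node has two parents, the concentration matrix has no entries outside the diagonal and
the edges. -/
lemma conc_apply_of_ne {p : ℕ} (G : OrderedDAG p)
    (hG : ∀ x y z, (x, z) ∈ G.edges → (y, z) ∈ G.edges → x = y) (a : G.Param) {x y : Fin p}
    (hxy : x ≠ y) : G.conc a x y = -(G.adj a x y + G.adj a y x) := by
  have h0 : ∑ m, G.adj a x m * G.adj a y m = 0 := by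
    refine Finset.sum_eq_zero fun m _ => ?_
    by_cases hx : (x, m) ∈ G.edges
    · have hy : (y, m) ∉ G.edges := fun hy => hxy (hG _ _ _ hx hy)
      simp [adj, hy]
    · simp [adj, hx]
  have h1 : G.conc a = G.adj a * (G.adj a).transpose - G.adj a - (G.adj a).transpose + 1 := by
    simp only [conc, Matrix.transpose_sub, Matrix.transpose_one]
    noncomm_ring
  have h2 : (G.adj a * (G.adj a).transpose) x y = 0 := by
    rw [Matrix.mul_apply]; exact h0
  rw [h1]
  simp only [Matrix.add_apply, Matrix.sub_apply, h2, Matrix.one_apply_ne hxy,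
    Matrix.transpose_apply]
  ring

lemma corr_comm {p : ℕ} (G : OrderedDAG p) (a : G.Param) (i j : Fin p) (S : Finset (Fin p)) :
    G.corr a i j S = G.corr a j i S := by
  unfold corr
  rw [minor_comm (G.transpose_conc a), Finset.pair_comm, mul_comm (minor (G.conc a) i i _)]

end OrderedDAG

/-! ### d-separation and partial correlations in forests -/

namespace OrderedDAG

variable {p : ℕ} (G : OrderedDAG p)

/-- Every node has at most one parent. -/
def IsForest : Prop := ∀ x y z, (x, z) ∈ G.edges → (y, z) ∈ G.edges → x = y

variable {G}

lemma IsForest.not_isColliderAt (hG : G.IsForest) {i j : Fin p} {P : G.skeleton.Walk i j}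
    (hP : P.IsPath) (n : ℕ) : ¬ G.IsColliderAt P n := by
  rintro ⟨h0, hn, h1, h2⟩
  have h := hP.getVert_injOn (by simp; omega) (by simp; omega) (hG _ _ _ h1 h2)
  omega

lemma IsForest.dSeparated_iff (hG : G.IsForest) {i j : Fin p} {S : Finset (Fin p)} :
    G.DSeparated i j S ↔ ∀ P : G.skeleton.Walk i j, ∃ x ∈ P.support, x ∈ S := by
  classical
  constructor
  · intro h P
    by_contra! hP
    refine h ⟨P.bypass, P.bypass_isPath, fun n _ => ⟨fun _ => ?_, fun hc => ?_⟩⟩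
    · exact hP _ (P.support_bypass_subset_support (SimpleGraph.Walk.getVert_mem_support _ _))
    · exact absurd hc (hG.not_isColliderAt P.bypass_isPath n)
  · rintro h ⟨P, hP, hS⟩
    obtain ⟨x, hx, hxS⟩ := h P
    obtain ⟨n, rfl, hn⟩ := SimpleGraph.Walk.mem_support_iff_exists_getVert.mp hx
    exact (hS n hn).1 (hG.not_isColliderAt hP n) hxS

lemma IsForest.dSeparated_comm (hG : G.IsForest) {i j : Fin p} {S : Finset (Fin p)} :
    G.DSeparated i j S ↔ G.DSeparated j i S := by
  rw [hG.dSeparated_iff, hG.dSeparated_iff]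
  exact ⟨fun h P => by simpa using h P.reverse, fun h P => by simpa using h P.reverse⟩

lemma skeleton_adj {x y : Fin p} : G.skeleton.Adj x y ↔ (x, y) ∈ G.edges ∨ (y, x) ∈ G.edges := by
  simp only [skeleton, SimpleGraph.fromRel_adj, and_iff_right_iff_imp]
  rintro (h | h)
  · exact (G.lt_of_mem _ h).ne
  · exact (G.lt_of_mem _ h).ne'

lemma IsForest.conc_ne_zero (hG : G.IsForest) {a : G.Param} {x y : Fin p} (h : G.conc a x y ≠ 0) :
    x = y ∨ (x, y) ∈ G.edges ∨ (y, x) ∈ G.edges := by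
  by_contra! hc
  exact h (by rw [G.conc_apply_of_ne hG a hc.1]; simp [adj, hc.2.1, hc.2.2])

lemma IsForest.abs_conc_edge (hG : G.IsForest) (a : G.Param) {x y : Fin p} (h : (x, y) ∈ G.edges) :
    |G.conc a x y| = |a ⟨(x, y), h⟩| := by
  have h' : (y, x) ∉ G.edges := fun h' => lt_asymm (G.lt_of_mem _ h) (G.lt_of_mem _ h')
  rw [G.conc_apply_of_ne hG a (G.lt_of_mem _ h).ne]
  simp [adj, h, h']

lemma IsForest.abs_conc_edge_symm (hG : G.IsForest) (a : G.Param) {x y : Fin p}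
    (h : (x, y) ∈ G.edges) : |G.conc a y x| = |a ⟨(x, y), h⟩| := by
  rw [← hG.abs_conc_edge a h]
  exact congrArg abs (congrFun (congrFun (G.transpose_conc a) x) y)

variable (G)

lemma not_mem_rest_left (i j : Fin p) (S : Finset (Fin p)) : i ∉ Finset.univ \ (S ∪ {i, j}) := by
  simp

lemma not_mem_rest_right (i j : Fin p) (S : Finset (Fin p)) : j ∉ Finset.univ \ (S ∪ {i, j}) := by
  simp

/-- A factorization of the minor gives one of the partial correlation, because the principal minors
in the denominator are positive and continuous. -/
lemma exists_abs_corr_eq_mul {i j : Fin p} {S : Finset (Fin p)} (f h : G.Param → ℝ)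
    (hc : Continuous h) (hpos : ∀ a, 0 < h a)
    (hm : ∀ a, |minor (G.conc a) i j (Finset.univ \ (S ∪ {i, j}))| = f a * h a) :
    ∃ h' : G.Param → ℝ, Continuous h' ∧ (∀ a, 0 < h' a) ∧ ∀ a, |G.corr a i j S| = f a * h' a := by
  have hD : ∀ a, 0 < √(minor (G.conc a) i i (Finset.univ \ (S ∪ {i, j})) *
      minor (G.conc a) j j (Finset.univ \ (S ∪ {i, j}))) := fun a =>
    Real.sqrt_pos.mpr (mul_pos (minor_self_pos (G.posDef_conc a) (not_mem_rest_left i j S))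
      (minor_self_pos (G.posDef_conc a) (not_mem_rest_right i j S)))
  refine ⟨fun a => h a / √(minor (G.conc a) i i (Finset.univ \ (S ∪ {i, j})) *
      minor (G.conc a) j j (Finset.univ \ (S ∪ {i, j}))), ?_, fun a => div_pos (hpos a) (hD a),
      fun a => ?_⟩
  · exact hc.div (Real.continuous_sqrt.comp ((continuous_minor G.continuous_conc _ _ _).mul
      (continuous_minor G.continuous_conc _ _ _))) fun a => (hD a).ne'
  · rw [corr, abs_div, hm, abs_of_pos (hD a), mul_div_assoc]

end OrderedDAG

/-! ### The chain -/

section Chain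

open OrderedDAG

variable {p : ℕ}

lemma mem_chainDAG {x y : Fin p} : (x, y) ∈ (chainDAG p).edges ↔ x.val + 1 = y.val := by
  simp [chainDAG]

lemma isForest_chainDAG : (chainDAG p).IsForest := by
  intro x y z hx hy
  rw [mem_chainDAG] at hx hy
  exact Fin.ext (by omega)

lemma exists_walk_chainDAG {i : Fin p} : ∀ (n : ℕ) (j : Fin p), j.val = i.val + n →
    ∃ P : (chainDAG p).skeleton.Walk i j, ∀ x ∈ P.support, i ≤ x ∧ x ≤ j := by
  intro n
  induction n with
  | zero =>
    intro j hj
    obtain rfl : j = i := Fin.ext (by omega)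
    exact ⟨.nil, by simp⟩
  | succ n ih =>
    intro j hj
    obtain ⟨P, hP⟩ := ih ⟨i.val + n, by omega⟩ rfl
    have hadj : (chainDAG p).skeleton.Adj ⟨i.val + n, by omega⟩ j :=
      skeleton_adj.mpr (Or.inl (mem_chainDAG.mpr (by simp; omega)))
    refine ⟨P.concat hadj, fun x hx => ?_⟩
    rw [SimpleGraph.Walk.support_concat, List.mem_append, List.mem_singleton] at hx
    rcases hx with hx | rfl
    · have := hP x hx
      simp only [Fin.le_def] at this ⊢
      omega
    · simp only [Fin.le_def]
      omega

lemma mem_support_of_chainDAG {s i j : Fin p} (P : (chainDAG p).skeleton.Walk i j) (hi : i ≤ s)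
    (hj : s ≤ j) : s ∈ P.support := by
  induction P with
  | nil => simp [le_antisymm hj hi]
  | @cons u v w hadj P ih =>
    rw [SimpleGraph.Walk.support_cons, List.mem_cons]
    rcases hi.eq_or_lt with rfl | hlt
    · exact Or.inl rfl
    · right
      refine ih ?_ hj
      rw [skeleton_adj, mem_chainDAG, mem_chainDAG] at hadj
      rw [Fin.lt_def] at hlt
      rw [Fin.le_def]
      omega

lemma dSeparated_chainDAG {i j : Fin p} (hij : i < j) {S : Finset (Fin p)} (hi : i ∉ S)
    (hj : j ∉ S) : (chainDAG p).DSeparated i j S ↔ ∃ s ∈ S, i < s ∧ s < j := by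
  rw [isForest_chainDAG.dSeparated_iff]
  constructor
  · intro h
    obtain ⟨P, hP⟩ := exists_walk_chainDAG (i := i) (j.val - i.val) j
      (by have := Fin.lt_def.mp hij; omega)
    obtain ⟨x, hx, hxS⟩ := h P
    exact ⟨x, hxS, lt_of_le_of_ne (hP x hx).1 fun h => hi (h ▸ hxS),
      lt_of_le_of_ne (hP x hx).2 fun h => hj (h ▸ hxS)⟩
  · rintro ⟨s, hs, h1, h2⟩ P
    exact ⟨s, mem_support_of_chainDAG P h1.le h2.le, hs⟩

lemma corr_chainDAG_eq_zero {i j s : Fin p} {S : Finset (Fin p)} (hs : s ∈ S) (his : i < s)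
    (hsj : s < j) (a : (chainDAG p).Param) : (chainDAG p).corr a i j S = 0 := by
  rw [corr, minor_eq_zero_of_separated _ (fun x => x < s) his hsj.not_gt, zero_div]
  intro x hx y hy hxs hys
  by_contra hne
  have hys' : y ≠ s := by
    rintro rfl
    rcases Finset.mem_insert.mp hy with rfl | hy
    · exact lt_irrefl _ hsj
    · simp [hs] at hy
  have h := isForest_chainDAG.conc_ne_zero hne
  rw [mem_chainDAG, mem_chainDAG] at h
  have h1 : y.val ≠ s.val := fun h => hys' (Fin.ext h)
  simp only [Fin.lt_def, Fin.ext_iff] at hxs hys h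
  omega

/-- The edges of the chain between `i` and `j`. -/
def chainSegment (i j : Fin p) : Finset ↥(chainDAG p).edges :=
  Finset.univ.filter fun e => i ≤ e.1.1 ∧ e.1.2 ≤ j

lemma exists_abs_corr_chainDAG {i j : Fin p} (hij : i < j) {S : Finset (Fin p)}
    (hS : ∀ s ∈ S, ¬ (i < s ∧ s < j)) :
    ∃ h : (chainDAG p).Param → ℝ, Continuous h ∧ (∀ a, 0 < h a) ∧
      ∀ a, |(chainDAG p).corr a i j S| = (∏ e ∈ chainSegment i j, |a e|) * h a := by
  have hij' := Fin.lt_def.mp hij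
  -- `v k = i + k` along the path, and `b` projects the chain onto the segment from `i` to `j`
  let v : ℕ → Fin p := fun k => if h : i.val + k < p then ⟨i.val + k, h⟩ else j
  have hv : ∀ k, k ≤ j.val - i.val → (v k).val = i.val + k := by
    intro k hk
    have : i.val + k < p := by omega
    simp [v, this]
  let b : Fin p → ℕ := fun x => min x.val j.val - i.val
  obtain ⟨h, hc, hpos, hh⟩ := exists_abs_minor_eq_prod_mul (chainDAG p).continuous_conc
    (chainDAG p).posDef_conc (i := i) (j := j) (not_mem_rest_left i j S) (not_mem_rest_right i j S)
    (m := j.val - i.val) (by omega) v b (Fin.ext (by rw [hv 0 (by omega)]; rfl))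
    (Fin.ext (by rw [hv _ le_rfl]; omega))
    (by
      intro k h0 hk
      have hvk := hv k hk.le
      simp only [Finset.mem_sdiff, Finset.mem_univ, true_and, Finset.mem_union, Finset.mem_insert,
        Finset.mem_singleton, not_or]
      refine ⟨fun hs => hS _ hs ?_, fun h => ?_, fun h => ?_⟩
      · simp only [Fin.lt_def]; omega
      · rw [h] at hvk; omega
      · rw [h] at hvk; omega)
    (by intro k hk; simp only [b, hv k hk]; omega)
    (by intro x; simp only [b]; omega)
    (by
      intro a x y hne
      have h := isForest_chainDAG.conc_ne_zero hne
      rw [mem_chainDAG, mem_chainDAG, Fin.ext_iff] at h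
      by_cases hb : b x = b y
      · exact Or.inl hb
      · right
        simp only [b] at hb
        refine ⟨min x.val y.val - i.val, by omega, ?_⟩
        have h1 := hv (min x.val y.val - i.val) (by omega)
        have h2 := hv (min x.val y.val - i.val + 1) (by omega)
        simp only [Fin.ext_iff, h1, h2]
        omega)
  refine exists_abs_corr_eq_mul _ _ h hc hpos fun a => ?_
  rw [hh]
  congr 1
  have hmem : ∀ k ∈ Finset.range (j.val - i.val), (v k, v (k + 1)) ∈ (chainDAG p).edges := by
    intro k hk
    rw [Finset.mem_range] at hk
    rw [mem_chainDAG, hv k hk.le, hv (k + 1) hk]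
    rfl
  refine Finset.prod_bij (fun k hk => ⟨(v k, v (k + 1)), hmem k hk⟩) ?_ ?_ ?_ ?_
  · intro k hk
    rw [Finset.mem_range] at hk
    simp only [chainSegment, Finset.mem_filter, Finset.mem_univ, true_and, Fin.le_def,
      hv k hk.le, hv (k + 1) hk]
    omega
  · intro k hk l hl h
    rw [Finset.mem_range] at hk hl
    have := congrArg Fin.val (congrArg (fun e => e.1.1) h)
    simp only [hv k hk.le, hv l hl.le] at this
    omega
  · rintro ⟨⟨x, y⟩, he⟩ hxy
    simp only [chainSegment, Finset.mem_filter, Finset.mem_univ, true_and, Fin.le_def] at hxy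
    have he' := mem_chainDAG.mp he
    refine ⟨x.val - i.val, Finset.mem_range.mpr (by omega), ?_⟩
    have h1 := hv (x.val - i.val) (by omega)
    have h2 := hv (x.val - i.val + 1) (by omega)
    refine Subtype.ext (Prod.ext (Fin.ext ?_) (Fin.ext ?_))
    · simp only [h1]; omega
    · simp only [h2]; omega
  · intro k hk
    exact isForest_chainDAG.abs_conc_edge a (hmem k hk)

lemma card_edges_chainDAG (p : ℕ) : Fintype.card ↥(chainDAG p).edges = p - 1 := by
  rw [← Fintype.card_fin (p - 1)]
  refine Fintype.card_congr
    { toFun := fun e => ⟨e.1.1.val, ?_⟩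
      invFun := fun k => ⟨(⟨k.val, ?_⟩, ⟨k.val + 1, ?_⟩), mem_chainDAG.mpr rfl⟩
      left_inv := ?_
      right_inv := ?_ }
  · have h : e.1.1.val + 1 = e.1.2.val := mem_chainDAG.mp e.2
    have := e.1.2.isLt
    omega
  · omega
  · omega
  · rintro ⟨⟨x, y⟩, h⟩
    refine Subtype.ext (Prod.ext rfl (Fin.ext ?_))
    exact mem_chainDAG.mp h
  · intro k
    rfl

lemma chainSegment_eq_univ {i j : Fin p} (hi : i.val = 0) (hj : j.val + 1 = p) :
    chainSegment i j = Finset.univ := by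
  ext ⟨⟨x, y⟩, h⟩
  simp only [chainSegment, Finset.mem_filter, Finset.mem_univ, true_and, Fin.le_def, iff_true]
  omega

end Chain

/-! ### The star -/

section Star

open OrderedDAG

variable {p : ℕ}

lemma mem_starDAG {x y : Fin p} : (x, y) ∈ (starDAG p).edges ↔ x.val = 0 ∧ 0 < y.val := by
  simp [starDAG]

lemma isForest_starDAG : (starDAG p).IsForest := by
  intro x y z hx hy
  rw [mem_starDAG] at hx hy
  exact Fin.ext (by omega)

/-- In the star, two nodes are d-separated exactly by the sets that contain the root. -/
lemma dSeparated_starDAG {o i j : Fin p} (ho : o.val = 0) (hij : i < j) {S : Finset (Fin p)}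
    (hi : i ∉ S) (hj : j ∉ S) : (starDAG p).DSeparated i j S ↔ o ∈ S := by
  have hij' := Fin.lt_def.mp hij
  rw [isForest_starDAG.dSeparated_iff]
  have hoj : (starDAG p).skeleton.Adj o j := skeleton_adj.mpr (Or.inl (mem_starDAG.mpr (by omega)))
  constructor
  · intro h
    by_cases hio : i = o
    · subst hio
      obtain ⟨x, hx, hxS⟩ := h (.cons hoj .nil)
      simp only [SimpleGraph.Walk.support_cons, SimpleGraph.Walk.support_nil, List.mem_cons,
        List.not_mem_nil, or_false] at hx
      rcases hx with rfl | rfl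
      · exact hxS
      · exact absurd hxS hj
    · have hi0 : i.val ≠ 0 := fun h => hio (Fin.ext (by omega))
      have hadj : (starDAG p).skeleton.Adj i o :=
        skeleton_adj.mpr (Or.inr (mem_starDAG.mpr (by omega)))
      obtain ⟨x, hx, hxS⟩ := h (.cons hadj (.cons hoj .nil))
      simp only [SimpleGraph.Walk.support_cons, SimpleGraph.Walk.support_nil, List.mem_cons,
        List.not_mem_nil, or_false] at hx
      rcases hx with rfl | rfl | rfl
      · exact absurd hxS hi
      · exact hxS
      · exact absurd hxS hj
  · intro hoS P
    refine ⟨o, ?_, hoS⟩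
    cases P with
    | nil => exact absurd hij (lt_irrefl _)
    | @cons _ v _ hadj P =>
      have hi0 : i.val ≠ 0 := fun h => hi ((Fin.ext (h.trans ho.symm) : i = o) ▸ hoS)
      rw [skeleton_adj, mem_starDAG, mem_starDAG] at hadj
      obtain rfl : v = o := Fin.ext (by omega)
      simp

lemma corr_starDAG_eq_zero {o i j : Fin p} (ho : o.val = 0) (hij : i < j) {S : Finset (Fin p)}
    (hi : i ∉ S) (hoS : o ∈ S) (a : (starDAG p).Param) : (starDAG p).corr a i j S = 0 := by
  have hij' := Fin.lt_def.mp hij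
  have hi0 : i.val ≠ 0 := fun h => hi ((Fin.ext (h.trans ho.symm) : i = o) ▸ hoS)
  rw [corr, minor_eq_zero_of_separated _ (fun x => x = i) rfl hij.ne', zero_div]
  rintro x - y hy rfl hyx
  by_contra hne
  have hyo : y.val ≠ 0 := by
    intro h0
    obtain rfl : y = o := Fin.ext (by omega)
    rcases Finset.mem_insert.mp hy with rfl | hy
    · omega
    · simp [hoS] at hy
  have h := isForest_starDAG.conc_ne_zero hne
  rw [mem_starDAG, mem_starDAG] at h
  rcases h with h | h | h
  · exact hyx h.symm
  · omega
  · omega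

/-- The edges of the star on the path between `i` and `j`; there is only one if `i` or `j` is the
root. -/
def starSegment (i j : Fin p) : Finset ↥(starDAG p).edges :=
  Finset.univ.filter fun e => e.1.2 = i ∨ e.1.2 = j

lemma starSegment_root {o j : Fin p} (ho : o.val = 0) (h : (o, j) ∈ (starDAG p).edges) :
    starSegment o j = {⟨(o, j), h⟩} := by
  ext ⟨⟨x, y⟩, hxy⟩
  have := mem_starDAG.mp hxy
  simp only [starSegment, Finset.mem_filter, Finset.mem_univ, true_and, Finset.mem_singleton,
    Subtype.mk.injEq, Prod.mk.injEq, Fin.ext_iff]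
  omega

lemma starSegment_leaves {o i j : Fin p} (ho : o.val = 0) (hi : (o, i) ∈ (starDAG p).edges)
    (hj : (o, j) ∈ (starDAG p).edges) :
    starSegment i j = {⟨(o, i), hi⟩, ⟨(o, j), hj⟩} := by
  ext ⟨⟨x, y⟩, hxy⟩
  have := mem_starDAG.mp hxy
  simp only [starSegment, Finset.mem_filter, Finset.mem_univ, true_and, Finset.mem_singleton,
    Finset.mem_insert, Subtype.mk.injEq, Prod.mk.injEq, Fin.ext_iff]
  omega

lemma exists_abs_corr_starDAG {o i j : Fin p} (ho : o.val = 0) (hij : i < j) {S : Finset (Fin p)}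
    (hoS : o ∉ S) :
    ∃ h : (starDAG p).Param → ℝ, Continuous h ∧ (∀ a, 0 < h a) ∧
      ∀ a, |(starDAG p).corr a i j S| = (∏ e ∈ starSegment i j, |a e|) * h a := by
  have hij' := Fin.lt_def.mp hij
  have hoj : (o, j) ∈ (starDAG p).edges := mem_starDAG.mpr (by omega)
  by_cases hio : i = o
  · subst hio
    obtain ⟨h, hc, hpos, hh⟩ := exists_abs_minor_eq_prod_mul (starDAG p).continuous_conc
      (starDAG p).posDef_conc (not_mem_rest_left i j S) (not_mem_rest_right i j S)
      (m := 1) one_pos (fun k => if k = 0 then i else j) (fun x => if x = j then 1 else 0)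
      (by simp) (by simp) (by intro k h0 hk; omega)
      (by
        intro k hk
        interval_cases k <;> simp [hij.ne])
      (by intro x; split_ifs <;> simp)
      (by
        intro a x y hne
        have h := isForest_starDAG.conc_ne_zero hne
        rw [mem_starDAG, mem_starDAG, Fin.ext_iff] at h
        by_cases hx : x = j <;> by_cases hy : y = j
        · simp [hx, hy]
        · right
          refine ⟨0, one_pos, Or.inr ⟨by simpa using hx, ?_⟩⟩
          subst hx
          simp only [if_true, Fin.ext_iff]
          omega
        · right
          refine ⟨0, one_pos, Or.inl ⟨?_, by simpa using hy⟩⟩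
          subst hy
          simp only [if_true, Fin.ext_iff]
          omega
        · simp [hx, hy])
    refine exists_abs_corr_eq_mul _ _ h hc hpos fun a => ?_
    rw [hh, starSegment_root ho hoj]
    simp [isForest_starDAG.abs_conc_edge a hoj]
  · have hi0 : i.val ≠ 0 := fun h => hio (Fin.ext (by omega))
    have hoi : (o, i) ∈ (starDAG p).edges := mem_starDAG.mpr (by omega)
    have hjo : j ≠ o := fun h => by rw [h] at hij'; omega
    obtain ⟨h, hc, hpos, hh⟩ := exists_abs_minor_eq_prod_mul (starDAG p).continuous_conc
      (starDAG p).posDef_conc (not_mem_rest_left i j S) (not_mem_rest_right i j S)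
      (m := 2) two_pos (fun k => if k = 0 then i else if k = 1 then o else j)
      (fun x => if x = i then 0 else if x = j then 2 else 1)
      (by simp) (by simp)
      (by
        intro k h0 hk
        obtain rfl : k = 1 := by omega
        simp [hoS, Ne.symm hio, hjo.symm])
      (by
        intro k hk
        interval_cases k <;> simp [hij.ne', Ne.symm hio, hjo.symm])
      (by intro x; split_ifs <;> simp)
      (by
        intro a x y hne
        have h := isForest_starDAG.conc_ne_zero hne
        rw [mem_starDAG, mem_starDAG] at h
        by_cases hxy : x = y
        · simp [hxy]
        have key : ∀ x y : Fin p, x.val = 0 ∧ 0 < y.val → x = o ∧ y ≠ o := by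
          intro x y h
          exact ⟨Fin.ext (by omega), fun h' => by rw [h'] at h; omega⟩
        rcases h with h | h | h
        · exact absurd h hxy
        · obtain ⟨rfl, hy⟩ := key _ _ h
          by_cases hyi : y = i
          · exact Or.inr ⟨0, by omega, Or.inr (by simp [hyi])⟩
          by_cases hyj : y = j
          · exact Or.inr ⟨1, by omega, Or.inl (by simp [hyj])⟩
          · left
            simp [hyi, hyj, Ne.symm hio, hjo.symm]
        · obtain ⟨rfl, hy⟩ := key _ _ h
          by_cases hyi : x = i
          · exact Or.inr ⟨0, by omega, Or.inl (by simp [hyi])⟩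
          by_cases hyj : x = j
          · exact Or.inr ⟨1, by omega, Or.inr (by simp [hyj])⟩
          · left
            simp [hyi, hyj, Ne.symm hio, hjo.symm])
    refine exists_abs_corr_eq_mul _ _ h hc hpos fun a => ?_
    have hne : (⟨(o, i), hoi⟩ : ↥(starDAG p).edges) ≠ ⟨(o, j), hoj⟩ := fun h => by
      simp only [Subtype.mk.injEq, Prod.mk.injEq, true_and] at h
      exact hij.ne h
    rw [hh, starSegment_leaves ho hoi hoj, Finset.prod_pair hne]
    simp [Finset.prod_range_succ, isForest_starDAG.abs_conc_edge a hoj,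
      isForest_starDAG.abs_conc_edge_symm a hoi]

lemma card_starSegment_le {o i j : Fin p} (ho : o.val = 0) (hij : i < j) :
    (starSegment i j).card ≤ 2 := by
  have hij' := Fin.lt_def.mp hij
  have hoj : (o, j) ∈ (starDAG p).edges := mem_starDAG.mpr (by omega)
  by_cases hio : i = o
  · subst hio
    rw [starSegment_root ho hoj]
    simp
  · have hi0 : i.val ≠ 0 := fun h => hio (Fin.ext (by omega))
    rw [starSegment_leaves ho (mem_starDAG.mpr (by omega)) hoj]
    exact Finset.card_le_two

lemma card_starSegment {o i j : Fin p} (ho : o.val = 0) (hi : 0 < i.val) (hij : i < j) :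
    (starSegment i j).card = 2 := by
  have hij' := Fin.lt_def.mp hij
  rw [starSegment_leaves ho (mem_starDAG.mpr (by omega)) (mem_starDAG.mpr (by omega))]
  refine Finset.card_pair fun h => ?_
  simp only [Subtype.mk.injEq, Prod.mk.injEq, true_and] at h
  exact hij.ne h

end Star

/-! ### The volume of the set where a product of coordinates is small -/

/-- The share of the cube `[-1, 1]^m` on which `∏ |x i| ≤ s`, for `s > 0`. -/
noncomputable def prodShare (m : ℕ) (s : ℝ) : ℝ :=
  if s < 1 then s * ∑ k ∈ Finset.range m, (-Real.log s) ^ k / (k.factorial : ℝ) else 1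

/-- The points of the box `∏ [-c i, c i]` whose coordinates in `J` have a product of absolute value
at most `s`. -/
def prodLeBox {ι : Type*} (c : ι → ℝ) (J : Finset ι) (s : ℝ) : Set (ι → ℝ) :=
  {a | a ∈ Set.Icc (-c) c ∧ ∏ i ∈ J, |a i| ≤ s}

lemma measurableSet_prodLeBox {ι : Type*} [Fintype ι] (c : ι → ℝ) (J : Finset ι) (s : ℝ) :
    MeasurableSet (prodLeBox c J s) := by
  have h : Continuous fun a : ι → ℝ => ∏ i ∈ J, |a i| := by fun_prop
  exact ((isClosed_Icc (a := -c) (b := c)).inter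
    (isClosed_le h (continuous_const (y := s)))).measurableSet

/-- The integral that links the shares in dimensions `m` and `m + 1`. -/
lemma integral_prodShare_div (m : ℕ) {s : ℝ} (hs : 0 < s) :
    ∫ r in (0 : ℝ)..1, prodShare m (s / r) = prodShare (m + 1) s := by
  rcases le_or_gt 1 s with h1 | h1
  · have : ∫ r in (0 : ℝ)..1, prodShare m (s / r) = ∫ r in (0 : ℝ)..1, (1 : ℝ) := by
      refine intervalIntegral.integral_congr_ae (Eventually.of_forall fun r hr => ?_)
      rw [Set.uIoc_of_le zero_le_one] at hr
      have : 1 ≤ s / r := (one_le_div hr.1).mpr (hr.2.trans h1)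
      simp [prodShare, this.not_gt]
    rw [this]
    simp [prodShare, h1.not_gt]
  · have e1 : Set.EqOn (fun r => prodShare m (s / r)) (fun _ => (1 : ℝ)) (Set.uIoc 0 s) := by
      intro r hr
      rw [Set.uIoc_of_le hs.le] at hr
      have : 1 ≤ s / r := (one_le_div hr.1).mpr hr.2
      simp [prodShare, this.not_gt]
    let F : ℝ → ℝ := fun r => s * ∑ k ∈ Finset.range m,
      (Real.log r - Real.log s) ^ (k + 1) / ((k + 1).factorial : ℝ)
    let f : ℝ → ℝ := fun r => s * ∑ k ∈ Finset.range m,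
      (Real.log r - Real.log s) ^ k / (k.factorial : ℝ) * r⁻¹
    have e2 : Set.EqOn (fun r => prodShare m (s / r)) f (Set.uIoc s 1) := by
      intro r hr
      rw [Set.uIoc_of_le h1.le] at hr
      have hr0 : 0 < r := hs.trans hr.1
      have : s / r < 1 := (div_lt_one hr0).mpr hr.1
      simp only [prodShare, if_pos this, f, Real.log_div hs.ne' hr0.ne', neg_sub,
        ← Finset.sum_mul]
      field_simp
    have hF : ∀ r ∈ Set.uIcc s 1, HasDerivAt F (f r) r := by
      intro r hr
      rw [Set.uIcc_of_le h1.le] at hr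
      have hr0 : 0 < r := hs.trans_le hr.1
      refine HasDerivAt.const_mul s (HasDerivAt.fun_sum fun k _ => ?_)
      have h := (((Real.hasDerivAt_log hr0.ne').sub_const (Real.log s)).pow (k + 1)).div_const
        ((k + 1).factorial : ℝ)
      refine h.congr_deriv ?_
      rw [Nat.factorial_succ]
      push_cast
      have : (k.factorial : ℝ) ≠ 0 := by positivity
      have : (k : ℝ) + 1 ≠ 0 := by positivity
      field_simp
    have hf : IntervalIntegrable f volume s 1 := by
      refine ContinuousOn.intervalIntegrable ?_
      intro r hr
      rw [Set.uIcc_of_le h1.le] at hr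
      have hr0 : r ≠ 0 := (hs.trans_le hr.1).ne'
      refine ContinuousAt.continuousWithinAt ?_
      refine continuousAt_const.mul (tendsto_finsetSum _ fun k _ => ?_)
      exact ((((Real.continuousAt_log hr0).sub continuousAt_const).pow k).div_const _).mul
        (continuousAt_inv₀ hr0)
    have i1 : IntervalIntegrable (fun r => prodShare m (s / r)) volume 0 s :=
      (intervalIntegrable_const (c := (1 : ℝ))).congr e1.symm
    have i2 : IntervalIntegrable (fun r => prodShare m (s / r)) volume s 1 := hf.congr e2.symm
    rw [← intervalIntegral.integral_add_adjacent_intervals i1 i2,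
      intervalIntegral.integral_congr_ae (Eventually.of_forall e1),
      intervalIntegral.integral_congr_ae (Eventually.of_forall e2),
      intervalIntegral.integral_eq_sub_of_hasDerivAt hF hf]
    simp only [F, prodShare, if_pos h1, Real.log_one, zero_sub, sub_self]
    rw [Finset.sum_range_succ']
    simp
    ring

lemma volume_prodLeBox_fin (m : ℕ) : ∀ s : ℝ, 0 < s →
    volume.real (prodLeBox (1 : Fin m → ℝ) Finset.univ s) = 2 ^ m * prodShare m s := by
  induction m with
  | zero =>
    intro s hs
    by_cases h : s < 1
    · have : prodLeBox (1 : Fin 0 → ℝ) Finset.univ s = ∅ := by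
        ext x; simp [prodLeBox, h]
      rw [this]; simp [prodShare, h]
    · have : prodLeBox (1 : Fin 0 → ℝ) Finset.univ s = Set.univ := by
        ext x
        simp only [prodLeBox, Finset.univ_eq_empty, Finset.prod_empty, Set.mem_ofPred_eq,
          Set.mem_univ, iff_true]
        exact ⟨⟨fun i => i.elim0, fun i => i.elim0⟩, not_lt.mp h⟩
      rw [this]; simp [prodShare, h, Measure.real, volume_pi]
  | succ m ih =>
    intro s hs
    let e := MeasurableEquiv.piFinSuccAbove (fun _ : Fin (m + 1) => ℝ) 0
    have he : MeasurePreserving e.symm :=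
      (volume_preserving_piFinSuccAbove (fun _ : Fin (m + 1) => ℝ) 0).symm
    have hA := measurableSet_prodLeBox (1 : Fin (m + 1) → ℝ) Finset.univ s
    have hB : MeasurableSet (e.symm ⁻¹' (prodLeBox (1 : Fin (m + 1) → ℝ) Finset.univ s)) :=
      e.symm.measurable hA
    have hslice : ∀ x : ℝ, x ≠ 0 →
        volume.real (Prod.mk x ⁻¹' (e.symm ⁻¹' (prodLeBox (1 : Fin (m + 1) → ℝ) Finset.univ s))) =
          (Set.Iic (1 : ℝ)).indicator (fun r => 2 ^ m * prodShare m (s / r)) |x| := by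
      intro x hx
      have hmem : ∀ y, y ∈ Prod.mk x ⁻¹' (e.symm ⁻¹' (prodLeBox (1 : Fin (m + 1) → ℝ)
          Finset.univ s)) ↔ |x| ≤ 1 ∧ y ∈ prodLeBox (1 : Fin m → ℝ) Finset.univ (s / |x|) := by
        intro y
        have hxy : e.symm (x, y) = Fin.cons x y := by
          simp [e, MeasurableEquiv.piFinSuccAbove_symm_apply, Fin.insertNthEquiv]
        simp only [Set.mem_preimage, hxy, prodLeBox, Set.mem_ofPred_eq, Set.mem_Icc, Pi.le_def,
          Fin.forall_fin_succ, Fin.prod_univ_succ, Fin.cons_zero, Fin.cons_succ, Pi.neg_apply,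
          Pi.one_apply, abs_le (a := x)]
        rw [le_div_iff₀ (abs_pos.mpr hx), mul_comm |x|]
        tauto
      by_cases h : |x| ≤ 1
      · rw [Set.indicator_of_mem (by exact h), ← ih _ (div_pos hs (abs_pos.mpr hx))]
        congr 1
        ext y
        rw [hmem]
        exact and_iff_right h
      · rw [Set.indicator_of_notMem (by exact h)]
        convert measureReal_empty
        ext y
        rw [hmem]
        simp [h]
    have hae : ∀ᵐ x : ℝ, x ≠ 0 := by simp [ae_iff]
    calc volume.real (prodLeBox (1 : Fin (m + 1) → ℝ) Finset.univ s)
        = (∫⁻ x : ℝ, volume (Prod.mk x ⁻¹'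
            (e.symm ⁻¹' (prodLeBox (1 : Fin (m + 1) → ℝ) Finset.univ s)))).toReal := by
          rw [Measure.real, ← he.measure_preimage hA.nullMeasurableSet, Measure.volume_eq_prod,
            Measure.prod_apply hB]
      _ = ∫ x : ℝ, volume.real (Prod.mk x ⁻¹'
            (e.symm ⁻¹' (prodLeBox (1 : Fin (m + 1) → ℝ) Finset.univ s))) := by
          refine (integral_toReal (measurable_measure_prodMk_left hB).aemeasurable ?_).symm
          filter_upwards [hae] with x hx
          refine lt_of_le_of_lt (measure_mono (t := Set.Icc (-1) 1) fun y hy => ?_)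
            isCompact_Icc.measure_lt_top
          have hxy : e.symm (x, y) = Fin.cons x y := by
            simp [e, MeasurableEquiv.piFinSuccAbove_symm_apply, Fin.insertNthEquiv]
          rw [Set.mem_preimage, Set.mem_preimage, hxy] at hy
          exact ⟨fun i => by simpa using hy.1.1 i.succ, fun i => by simpa using hy.1.2 i.succ⟩
      _ = ∫ x : ℝ, (Set.Iic (1 : ℝ)).indicator (fun r => 2 ^ m * prodShare m (s / r)) |x| := by
          refine integral_congr_ae ?_
          filter_upwards [hae] with x hx using hslice x hx
      _ = 2 ^ (m + 1) * prodShare (m + 1) s := by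
          rw [integral_comp_abs, setIntegral_indicator measurableSet_Iic, Set.Ioi_inter_Iic,
            ← intervalIntegral.integral_of_le zero_le_one, intervalIntegral.integral_const_mul,
            integral_prodShare_div m hs]
          ring

lemma volume_prodLeBox_univ {κ : Type*} [Fintype κ] {s : ℝ} (hs : 0 < s) :
    volume.real (prodLeBox (1 : κ → ℝ) Finset.univ s) =
      2 ^ Fintype.card κ * prodShare (Fintype.card κ) s := by
  rw [← volume_prodLeBox_fin _ s hs]
  let e := MeasurableEquiv.piCongrLeft (fun _ : κ => ℝ) (Fintype.equivFin κ).symm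
  have he : MeasurePreserving e := volume_measurePreserving_piCongrLeft _ _
  have hA := measurableSet_prodLeBox (1 : κ → ℝ) Finset.univ s
  rw [Measure.real, ← he.measure_preimage hA.nullMeasurableSet, Measure.real]
  congr 2
  ext x
  have hx : ∀ i, e x i = x (Fintype.equivFin κ i) := by
    intro i
    have := MeasurableEquiv.piCongrLeft_apply_apply (β := fun _ : κ => ℝ)
      (Fintype.equivFin κ).symm x (Fintype.equivFin κ i)
    simpa [e] using this
  simp only [Set.mem_preimage, prodLeBox, Set.mem_ofPred_eq, Set.mem_Icc, Pi.le_def, hx,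
    Pi.neg_apply, Pi.one_apply]
  rw [Equiv.prod_comp (Fintype.equivFin κ) (fun i => |x i|),
    (Fintype.equivFin κ).forall_congr_left (p := fun i => -1 ≤ x (Fintype.equivFin κ i)),
    (Fintype.equivFin κ).forall_congr_left (p := fun i => x (Fintype.equivFin κ i) ≤ 1)]
  simp

/-- The coordinates outside `J` are unconstrained, so they only contribute a factor. -/
lemma volume_prodLeBox {ι : Type*} [Fintype ι] {c : ι → ℝ} (hc : ∀ i, 0 ≤ c i) {J : Finset ι}
    (hJ : ∀ i ∈ J, c i = 1) {s : ℝ} (hs : 0 < s) :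
    volume.real (prodLeBox c J s) = (∏ i, 2 * c i) * prodShare J.card s := by
  classical
  let e := MeasurableEquiv.piEquivPiSubtypeProd (fun _ : ι => ℝ) (· ∈ J)
  have he : MeasurePreserving e := by
    convert volume_preserving_piEquivPiSubtypeProd (fun _ : ι => ℝ) (· ∈ J)
  have hset : prodLeBox c J s = e ⁻¹' (prodLeBox (1 : {i // i ∈ J} → ℝ) Finset.univ s ×ˢ
      Set.Icc (-fun i : {i // i ∉ J} => c i) (fun i : {i // i ∉ J} => c i)) := by
    ext a
    have h1 : ∏ i ∈ J, |a i| = ∏ i : {i // i ∈ J}, |a i| := (Finset.prod_coe_sort J _).symm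
    have h2 : ∀ f : ι → ℝ, ∀ g : ι → ℝ, f ≤ g ↔
        (∀ i : {i // i ∈ J}, f i ≤ g i) ∧ ∀ i : {i // i ∉ J}, f i ≤ g i := by
      intro f g
      constructor
      · exact fun h => ⟨fun i => h i, fun i => h i⟩
      · intro h i
        by_cases hi : i ∈ J
        · exact h.1 ⟨i, hi⟩
        · exact h.2 ⟨i, hi⟩
    have h3 : ∀ i : {i // i ∈ J}, c i = 1 := fun i => hJ i i.2
    simp only [prodLeBox, Set.mem_ofPred_eq, Set.mem_Icc, h1, h2, Set.mem_preimage, Set.mem_prod]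
    simp only [Pi.le_def, Pi.neg_apply, h3, Pi.one_apply, e]
    change _ ↔ (((∀ i : {i // i ∈ J}, -1 ≤ a i) ∧ (∀ i : {i // i ∈ J}, a i ≤ 1)) ∧
      ∏ i : {i // i ∈ J}, |a i| ≤ s) ∧
      (∀ i : {i // i ∉ J}, -c i ≤ a i) ∧ (∀ i : {i // i ∉ J}, a i ≤ c i)
    tauto
  have hmeas := (measurableSet_prodLeBox (1 : {i // i ∈ J} → ℝ) Finset.univ s).prod
    (measurableSet_Icc (a := -fun i : {i // i ∉ J} => c i) (b := fun i : {i // i ∉ J} => c i))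
  rw [hset, Measure.real, he.measure_preimage hmeas.nullMeasurableSet, ← Measure.real,
    Measure.volume_eq_prod, measureReal_prod_prod, volume_prodLeBox_univ hs, Measure.real,
    Real.volume_Icc_pi_toReal (fun i => by simpa using (hc i))]
  have h4 : ∏ i, 2 * c i = (∏ i ∈ J, 2 * c i) * ∏ i : {i // i ∉ J}, 2 * c i := by
    rw [← Finset.prod_mul_prod_compl J]
    congr 1
    exact Finset.prod_subtype _ (by simp) _
  have h5 : ∏ i ∈ J, 2 * c i = 2 ^ J.card := by
    rw [Finset.prod_congr rfl fun i hi => by rw [hJ i hi, mul_one], Finset.prod_const]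
  rw [h4, h5]
  simp only [Fintype.card_coe, Pi.neg_apply, sub_neg_eq_add, two_mul]
  ring

/-! ### Rates of convergence -/

/-- The growth rate `t (-log t)^(m-1)` of the volume of `{∏ |x i| ≤ t}` in the `m`-cube. -/
noncomputable def logRate (m : ℕ) (t : ℝ) : ℝ := t * (-Real.log t) ^ (m - 1)

lemma tendsto_neg_log_nhdsGT_zero : Tendsto (fun t => -Real.log t) (𝓝[>] 0) atTop :=
  tendsto_neg_atBot_atTop.comp Real.tendsto_log_nhdsGT_zero

lemma eventually_logRate_pos (m : ℕ) : ∀ᶠ t in 𝓝[>] (0 : ℝ), 0 < t ∧ 0 < logRate m t := by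
  filter_upwards [self_mem_nhdsWithin, tendsto_neg_log_nhdsGT_zero.eventually_gt_atTop 0]
    with t ht hL
  exact ⟨ht, mul_pos ht (pow_pos hL _)⟩

lemma tendsto_prodShare_div_logRate {k m : ℕ} (hm : 0 < m) (hk : k ≤ m) {c : ℝ} (hc : 0 < c) :
    Tendsto (fun t => prodShare k (c * t) / logRate m t) (𝓝[>] 0)
      (𝓝 (if k = m then c / ((m - 1).factorial : ℝ) else 0)) := by
  have hL := tendsto_neg_log_nhdsGT_zero
  have hratio : Tendsto (fun t => (-Real.log (c * t)) / (-Real.log t)) (𝓝[>] 0) (𝓝 1) := by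
    have h1 : Tendsto (fun t => (-Real.log c) / (-Real.log t) + 1) (𝓝[>] 0) (𝓝 (0 + 1)) :=
      (tendsto_const_nhds.div_atTop hL).add_const 1
    rw [zero_add] at h1
    refine h1.congr' ?_
    filter_upwards [self_mem_nhdsWithin, hL.eventually_gt_atTop 0] with t ht hLt
    rw [Real.log_mul hc.ne' (ne_of_gt ht)]
    have : Real.log t ≠ 0 := by linarith
    field_simp
  have hterm : ∀ l < m, Tendsto (fun t => (-Real.log (c * t)) ^ l / (-Real.log t) ^ (m - 1))
      (𝓝[>] 0) (𝓝 (if l = m - 1 then 1 else 0)) := by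
    intro l hl
    have h1 : Tendsto (fun t => ((-Real.log (c * t)) / (-Real.log t)) ^ l *
        ((-Real.log t)⁻¹) ^ (m - 1 - l)) (𝓝[>] 0) (𝓝 (1 ^ l * 0 ^ (m - 1 - l))) :=
      (hratio.pow l).mul ((tendsto_inv_atTop_zero.comp hL).pow _)
    have h2 : (1 : ℝ) ^ l * 0 ^ (m - 1 - l) = if l = m - 1 then 1 else 0 := by
      split_ifs with h
      · simp [h]
      · simp [zero_pow (show m - 1 - l ≠ 0 by omega)]
    rw [h2] at h1
    refine h1.congr' ?_
    filter_upwards [hL.eventually_gt_atTop 0] with t hLt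
    have h3 : (-Real.log t) ^ (m - 1) = (-Real.log t) ^ l * (-Real.log t) ^ (m - 1 - l) := by
      rw [← pow_add]; congr 1; omega
    rw [h3, div_pow, inv_pow]
    field_simp
  have hsum : Tendsto (fun t => c * ∑ l ∈ Finset.range k,
      (-Real.log (c * t)) ^ l / (-Real.log t) ^ (m - 1) / (l.factorial : ℝ)) (𝓝[>] 0)
      (𝓝 (c * ∑ l ∈ Finset.range k, (if l = m - 1 then 1 else 0) / (l.factorial : ℝ))) :=
    (tendsto_finsetSum _ fun l hl =>
      (hterm l (by have := Finset.mem_range.mp hl; omega)).div_const _).const_mul c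
  have hval : c * ∑ l ∈ Finset.range k, (if l = m - 1 then (1 : ℝ) else 0) / (l.factorial : ℝ) =
      if k = m then c / ((m - 1).factorial : ℝ) else 0 := by
    simp only [ite_div, zero_div, Finset.sum_ite_eq', Finset.mem_range]
    by_cases h : k = m
    · rw [if_pos (by omega), if_pos h]; ring
    · rw [if_neg (by omega), if_neg h, mul_zero]
  rw [hval] at hsum
  refine hsum.congr' ?_
  have hsmall : ∀ᶠ t in 𝓝[>] (0 : ℝ), c * t < 1 := by
    have : Tendsto (fun t => c * t) (𝓝[>] (0 : ℝ)) (𝓝 (c * 0)) :=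
      (continuous_const.mul continuous_id).continuousWithinAt
    rw [mul_zero] at this
    exact this.eventually_lt_const one_pos
  filter_upwards [self_mem_nhdsWithin, hsmall, hL.eventually_gt_atTop 0] with t ht hct hLt
  have ht' : t ≠ 0 := ne_of_gt ht
  rw [prodShare, if_pos hct, logRate, Finset.mul_sum, Finset.mul_sum, Finset.sum_div]
  refine Finset.sum_congr rfl fun l _ => ?_
  have := (pow_pos hLt (m - 1)).ne'
  field_simp

/-- Only `prodLeBox` sets with the maximal number of factors contribute at the rate of that
number. -/
lemma tendsto_volume_prodLeBox {ι : Type*} [Fintype ι] {c : ι → ℝ} (hc : ∀ i, 0 ≤ c i)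
    {J : Finset ι} (hJ : ∀ i ∈ J, c i = 1) {m : ℕ} (hm : 0 < m) (hJm : J.card ≤ m) {M : ℝ}
    (hM : 0 < M) :
    Tendsto (fun t => volume.real (prodLeBox c J (M * t)) / logRate m t) (𝓝[>] 0)
      (𝓝 ((∏ i, 2 * c i) * if J.card = m then M / ((m - 1).factorial : ℝ) else 0)) := by
  refine ((tendsto_prodShare_div_logRate hm hJm hM).const_mul (∏ i, 2 * c i)).congr' ?_
  filter_upwards [self_mem_nhdsWithin] with t ht
  rw [volume_prodLeBox hc hJ (mul_pos hM ht), mul_div_assoc]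

/-! ### Small products in the cube, with a weight and a density -/

/-- The points of the cube `[-1, 1]^ι` whose coordinates in `J` have a product of absolute value at
most `t * w a`. -/
def prodLeSet {ι : Type*} (J : Finset ι) (w : (ι → ℝ) → ℝ) (t : ℝ) : Set (ι → ℝ) :=
  {a | a ∈ Set.Icc (-1) 1 ∧ ∏ i ∈ J, |a i| ≤ t * w a}

section

variable {ι : Type*}

lemma prodLeSet_subset_Icc (J : Finset ι) (w : (ι → ℝ) → ℝ) (t : ℝ) :
    prodLeSet J w t ⊆ Set.Icc (-1) 1 := fun _ h => h.1

lemma prodLeBox_subset_Icc (J : Finset ι) (s : ℝ) :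
    prodLeBox 1 J s ⊆ Set.Icc (-1) 1 := fun _ h => h.1

lemma measurableSet_prodLeSet [Fintype ι] (J : Finset ι) {w : (ι → ℝ) → ℝ}
    (hw : Continuous w) (t : ℝ) : MeasurableSet (prodLeSet J w t) := by
  have h : Continuous fun a : ι → ℝ => ∏ i ∈ J, |a i| := by fun_prop
  exact ((isClosed_Icc (a := -1) (b := 1)).inter
    (isClosed_le h (continuous_const.mul hw))).measurableSet

lemma prodLeSet_subset_prodLeBox (J : Finset ι) {w : (ι → ℝ) → ℝ} {M t : ℝ} (ht : 0 ≤ t)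
    (hM : ∀ a ∈ Set.Icc (-1 : ι → ℝ) 1, w a ≤ M) : prodLeSet J w t ⊆ prodLeBox 1 J (M * t) := by
  intro a ha
  refine ⟨ha.1, ha.2.trans ?_⟩
  rw [mul_comm]
  exact mul_le_mul_of_nonneg_right (hM a ha.1) ht

lemma zero_mem_Icc_cube : (0 : ι → ℝ) ∈ Set.Icc (-1 : ι → ℝ) 1 :=
  ⟨fun i => by simp, fun i => by simp⟩

lemma exists_upper_bound_cube {w : (ι → ℝ) → ℝ} (hw : Continuous w) (h0 : ∀ a, 0 < w a) :
    ∃ M, 0 < M ∧ ∀ a ∈ Set.Icc (-1 : ι → ℝ) 1, w a ≤ M := by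
  obtain ⟨M, hM⟩ := isCompact_Icc.exists_bound_of_continuousOn (s := Set.Icc (-1 : ι → ℝ) 1)
    hw.continuousOn
  have hM' : ∀ a ∈ Set.Icc (-1 : ι → ℝ) 1, w a ≤ M := fun a ha => (le_abs_self _).trans (hM a ha)
  exact ⟨M, (h0 0).trans_le (hM' 0 zero_mem_Icc_cube), hM'⟩

variable [Fintype ι]

lemma volume_lt_top_of_subset_cube {A : Set (ι → ℝ)} (hA : A ⊆ Set.Icc (-1) 1) : volume A < ⊤ :=
  (measure_mono hA).trans_lt isCompact_Icc.measure_lt_top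

lemma integrableOn_of_subset_cube {φ : (ι → ℝ) → ℝ} (hφ : Continuous φ) {A : Set (ι → ℝ)}
    (hA : A ⊆ Set.Icc (-1) 1) : IntegrableOn φ A :=
  (hφ.continuousOn.integrableOn_compact isCompact_Icc).mono_set hA

lemma setIntegral_le_mul_volume {φ : (ι → ℝ) → ℝ} (hφ : Continuous φ) {A : Set (ι → ℝ)}
    (hA : A ⊆ Set.Icc (-1) 1) (hAm : MeasurableSet A) {Φ : ℝ} (hΦ : ∀ a ∈ A, φ a ≤ Φ) :
    ∫ a in A, φ a ≤ Φ * volume.real A := by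
  have h := setIntegral_mono_on (integrableOn_of_subset_cube hφ hA)
    (integrableOn_const (C := Φ) (hs := (volume_lt_top_of_subset_cube hA).ne)) hAm hΦ
  rwa [setIntegral_const, smul_eq_mul, mul_comm] at h

lemma mul_volume_le_setIntegral {φ : (ι → ℝ) → ℝ} (hφ : Continuous φ) {A : Set (ι → ℝ)}
    (hA : A ⊆ Set.Icc (-1) 1) (hAm : MeasurableSet A) {Φ : ℝ} (hΦ : ∀ a ∈ A, Φ ≤ φ a) :
    Φ * volume.real A ≤ ∫ a in A, φ a := by
  have h := setIntegral_mono_on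
    (integrableOn_const (C := Φ) (hs := (volume_lt_top_of_subset_cube hA).ne))
    (integrableOn_of_subset_cube hφ hA) hAm hΦ
  rwa [setIntegral_const, smul_eq_mul, mul_comm] at h

lemma tendsto_volume_prodLeBox_one {J : Finset ι} {m : ℕ} (hm : 0 < m) (hJm : J.card ≤ m) {M : ℝ}
    (hM : 0 < M) :
    Tendsto (fun t => volume.real (prodLeBox 1 J (M * t)) / logRate m t) (𝓝[>] 0)
      (𝓝 (2 ^ Fintype.card ι * if J.card = m then M / ((m - 1).factorial : ℝ) else 0)) := by
  have h := tendsto_volume_prodLeBox (c := (1 : ι → ℝ)) (J := J) (fun _ => zero_le_one)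
    (fun _ _ => rfl) hm hJm hM
  simpa using h

/-- The asymptotics when all coordinates are constrained. If some coordinate is larger than `ε`,
then the product of the others is at most a multiple of `t`, and the volume where this happens is of
smaller order. So only the values of the density and of the weight at the origin count. -/
lemma tendsto_setIntegral_prodLeSet_univ [Nonempty ι] {φ w : (ι → ℝ) → ℝ} (hφ : Continuous φ)
    (hφ0 : ∀ a, 0 < φ a) (hw : Continuous w) (hw0 : ∀ a, 0 < w a) :
    Tendsto (fun t => (∫ a in prodLeSet Finset.univ w t, φ a) / logRate (Fintype.card ι) t)
      (𝓝[>] 0)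
      (𝓝 (φ 0 * (2 ^ Fintype.card ι * (w 0 / ((Fintype.card ι - 1).factorial : ℝ))))) := by
  classical
  set m := Fintype.card ι with hm
  have hm0 : 0 < m := Fintype.card_pos
  obtain ⟨M, hM0, hM⟩ := exists_upper_bound_cube hw hw0
  obtain ⟨Φ, hΦ0, hΦ⟩ := exists_upper_bound_cube hφ hφ0
  let lim : ℝ → ℝ := fun η => (φ 0 + η) * (2 ^ m * ((w 0 + η) / ((m - 1).factorial : ℝ)))
  have hlim : Continuous lim := by fun_prop
  have key : ∀ η, 0 < η → η < φ 0 → η < w 0 → ∃ u l : ℝ → ℝ,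
      Tendsto u (𝓝[>] 0) (𝓝 (lim η)) ∧ Tendsto l (𝓝[>] 0) (𝓝 (lim (-η))) ∧
      ∀ᶠ t in 𝓝[>] 0, (∫ a in prodLeSet Finset.univ w t, φ a) / logRate m t ≤ u t ∧
        l t ≤ (∫ a in prodLeSet Finset.univ w t, φ a) / logRate m t := by
    intro η hη hηφ hηw
    obtain ⟨ε, hε, hball⟩ : ∃ ε > 0, ∀ a : ι → ℝ, (∀ k, |a k| ≤ ε) →
        |φ a - φ 0| < η ∧ |w a - w 0| < η := by
      obtain ⟨ε₁, hε₁, h₁⟩ := Metric.continuous_iff.mp hφ 0 η hη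
      obtain ⟨ε₂, hε₂, h₂⟩ := Metric.continuous_iff.mp hw 0 η hη
      refine ⟨min ε₁ ε₂ / 2, by positivity, fun a ha => ?_⟩
      have hd : dist a 0 ≤ min ε₁ ε₂ / 2 :=
        (dist_pi_le_iff (by positivity)).mpr fun k => by simpa using ha k
      have hmin : 0 < min ε₁ ε₂ := lt_min hε₁ hε₂
      have h3 := min_le_left ε₁ ε₂
      have h4 := min_le_right ε₁ ε₂
      exact ⟨h₁ a (by linarith), h₂ a (by linarith)⟩
    -- where `∏ |a i| ≤ M * t`, a coordinate larger than `ε` makes the product of the others small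
    let out : ℝ → Set (ι → ℝ) := fun t => ⋃ k, prodLeBox 1 (Finset.univ.erase k) (M / ε * t)
    have hout_cube : ∀ t, out t ⊆ Set.Icc (-1) 1 := fun t =>
      Set.iUnion_subset fun k => prodLeBox_subset_Icc _ _
    have hout_meas : ∀ t, MeasurableSet (out t) := fun t =>
      MeasurableSet.iUnion fun k => measurableSet_prodLeBox _ _ _
    have hout : Tendsto (fun t => volume.real (out t) / logRate m t) (𝓝[>] 0) (𝓝 0) := by
      have hcard : ∀ k : ι, (Finset.univ.erase k).card = m - 1 := fun k => by
        rw [Finset.card_erase_of_mem (Finset.mem_univ k), Finset.card_univ]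
      have hsum : Tendsto (fun t => ∑ k : ι, volume.real (prodLeBox 1 (Finset.univ.erase k)
          (M / ε * t)) / logRate m t) (𝓝[>] 0) (𝓝 (∑ _k : ι, 0)) := by
        refine tendsto_finsetSum _ fun k _ => ?_
        have h := tendsto_volume_prodLeBox_one (J := Finset.univ.erase k) hm0
          (by rw [hcard]; omega) (div_pos hM0 hε)
        rwa [hcard, if_neg (by omega), mul_zero] at h
      rw [Finset.sum_const_zero] at hsum
      refine tendsto_of_tendsto_of_tendsto_of_le_of_le' tendsto_const_nhds hsum ?_ ?_
      · filter_upwards [eventually_logRate_pos m] with t ht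
        exact div_nonneg measureReal_nonneg ht.2.le
      · filter_upwards [eventually_logRate_pos m] with t ht
        rw [← Finset.sum_div]
        exact div_le_div_of_nonneg_right (measureReal_iUnion_fintype_le _) ht.2.le
    have hin : ∀ t, 0 < t → ∀ a ∈ Set.Icc (-1 : ι → ℝ) 1, ∏ i, |a i| ≤ M * t → a ∉ out t →
        |φ a - φ 0| < η ∧ |w a - w 0| < η := by
      intro t ht a ha hprod hnot
      refine hball a fun k => ?_
      by_contra! hk
      refine hnot (Set.mem_iUnion.mpr ⟨k, ha, ?_⟩)
      rw [div_mul_eq_mul_div, le_div_iff₀ hε]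
      refine le_trans ?_ hprod
      rw [← Finset.prod_erase_mul _ _ (Finset.mem_univ k)]
      exact mul_le_mul_of_nonneg_left hk.le (Finset.prod_nonneg fun _ _ => abs_nonneg _)
    have hbox : ∀ c, 0 < c → Tendsto (fun t => volume.real (prodLeBox (1 : ι → ℝ) Finset.univ
        (c * t)) / logRate m t) (𝓝[>] 0) (𝓝 (2 ^ m * (c / ((m - 1).factorial : ℝ)))) := by
      intro c hc
      have h := tendsto_volume_prodLeBox_one (J := (Finset.univ : Finset ι)) hm0
        Finset.card_univ.le hc
      rwa [Finset.card_univ, if_pos rfl] at h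
    refine ⟨fun t => Φ * (volume.real (out t) / logRate m t) + (φ 0 + η) *
        (volume.real (prodLeBox (1 : ι → ℝ) Finset.univ ((w 0 + η) * t)) / logRate m t),
      fun t => (φ 0 - η) * (volume.real (prodLeBox (1 : ι → ℝ) Finset.univ ((w 0 - η) * t)) /
        logRate m t - volume.real (out t) / logRate m t), ?_, ?_, ?_⟩
    · have h := (hout.const_mul Φ).add ((hbox (w 0 + η) (by linarith)).const_mul (φ 0 + η))
      rwa [mul_zero, zero_add] at h
    · have h := ((hbox (w 0 - η) (by linarith)).sub hout).const_mul (φ 0 - η)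
      rwa [sub_zero] at h
    · filter_upwards [eventually_logRate_pos m] with t ht
      obtain ⟨ht0, hg⟩ := ht
      set E := prodLeSet Finset.univ w t with hE
      have hEc : E ⊆ Set.Icc (-1) 1 := prodLeSet_subset_Icc _ _ _
      have hEm : MeasurableSet E := measurableSet_prodLeSet _ hw t
      have hEM : E ⊆ prodLeBox 1 Finset.univ (M * t) := prodLeSet_subset_prodLeBox _ ht0.le hM
      have hsplit : (∫ a in E ∩ out t, φ a) + ∫ a in E \ out t, φ a = ∫ a in E, φ a :=
        integral_inter_add_sdiff (hout_meas t) (integrableOn_of_subset_cube hφ hEc)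
      constructor
      · have h1 : ∫ a in E ∩ out t, φ a ≤ Φ * volume.real (out t) :=
          (setIntegral_le_mul_volume hφ (Set.inter_subset_left.trans hEc)
            (hEm.inter (hout_meas t)) fun a ha => hΦ a (hEc ha.1)).trans
          (mul_le_mul_of_nonneg_left (measureReal_mono Set.inter_subset_right
            (volume_lt_top_of_subset_cube (hout_cube t)).ne) hΦ0.le)
        have h2 : ∫ a in E \ out t, φ a ≤ (φ 0 + η) *
            volume.real (prodLeBox (1 : ι → ℝ) Finset.univ ((w 0 + η) * t)) := by
          refine (setIntegral_le_mul_volume hφ (Set.sdiff_subset.trans hEc)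
            (hEm.diff (hout_meas t)) fun a ha => ?_).trans
            (mul_le_mul_of_nonneg_left (measureReal_mono (fun a ha => ?_)
              (volume_lt_top_of_subset_cube (prodLeBox_subset_Icc _ _)).ne) (by linarith))
          · have := abs_lt.mp (hin t ht0 a (hEc ha.1) (hEM ha.1).2 ha.2).1
            linarith
          · have h := abs_lt.mp (hin t ht0 a (hEc ha.1) (hEM ha.1).2 ha.2).2
            refine ⟨hEc ha.1, ha.1.2.trans ?_⟩
            rw [mul_comm]
            exact mul_le_mul_of_nonneg_right (by linarith) ht0.le
        rw [← mul_div_assoc, ← mul_div_assoc, ← add_div, ← hsplit]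
        exact div_le_div_of_nonneg_right (add_le_add h1 h2) hg.le
      · set B := prodLeBox (1 : ι → ℝ) Finset.univ ((w 0 - η) * t) with hB
        have hBc : B ⊆ Set.Icc (-1) 1 := prodLeBox_subset_Icc _ _
        have hBm : MeasurableSet B := measurableSet_prodLeBox _ _ _
        have hBin : ∀ a ∈ B \ out t, |φ a - φ 0| < η ∧ |w a - w 0| < η := fun a ha =>
          hin t ht0 a (hBc ha.1) (ha.1.2.trans (mul_le_mul_of_nonneg_right
            (by have := hM 0 zero_mem_Icc_cube; linarith) ht0.le)) ha.2
        have h1 : volume.real B - volume.real (out t) ≤ volume.real (B \ out t) :=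
          le_measureReal_sdiff (volume_lt_top_of_subset_cube (hout_cube t)).ne
        have h2 : (φ 0 - η) * volume.real (B \ out t) ≤ ∫ a in B \ out t, φ a :=
          mul_volume_le_setIntegral hφ (Set.sdiff_subset.trans hBc) (hBm.diff (hout_meas t))
            fun a ha => by have := abs_lt.mp (hBin a ha).1; linarith
        have h3 : ∫ a in B \ out t, φ a ≤ ∫ a in E, φ a := by
          refine setIntegral_mono_set (integrableOn_of_subset_cube hφ hEc)
            (Eventually.of_forall fun a => (hφ0 a).le) (LE.le.eventuallyLE ?_)
          intro a ha
          have h := abs_lt.mp (hBin a ha).2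
          refine ⟨hBc ha.1, ha.1.2.trans ?_⟩
          rw [mul_comm t]
          exact mul_le_mul_of_nonneg_right (by linarith) ht0.le
        rw [← sub_div, ← mul_div_assoc]
        exact div_le_div_of_nonneg_right
          (((mul_le_mul_of_nonneg_left h1 (by linarith)).trans h2).trans h3) hg.le
  have hlim0 : φ 0 * (2 ^ m * (w 0 / ((m - 1).factorial : ℝ))) = lim 0 := by simp [lim]
  rw [hlim0]
  have hsmall : ∀ᶠ η in 𝓝[>] (0 : ℝ), 0 < η ∧ η < φ 0 ∧ η < w 0 := by
    filter_upwards [self_mem_nhdsWithin,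
      mem_nhdsWithin_of_mem_nhds (Iio_mem_nhds (hφ0 0)),
      mem_nhdsWithin_of_mem_nhds (Iio_mem_nhds (hw0 0))] with η h1 h2 h3
    exact ⟨h1, h2, h3⟩
  refine tendsto_order.mpr ⟨fun x hx => ?_, fun x hx => ?_⟩
  · have h : Tendsto (fun η => lim (-η)) (𝓝[>] 0) (𝓝 (lim (-0))) :=
      (hlim.comp continuous_neg).continuousWithinAt
    rw [neg_zero] at h
    obtain ⟨η, ⟨h1, h2, h3⟩, h4⟩ := (hsmall.and (h.eventually_const_lt hx)).exists
    obtain ⟨u, l, -, hl, hul⟩ := key η h1 h2 h3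
    filter_upwards [hul, hl.eventually_const_lt h4] with t h5 h6
    exact h6.trans_le h5.2
  · have h : Tendsto lim (𝓝[>] 0) (𝓝 (lim 0)) := hlim.continuousWithinAt
    obtain ⟨η, ⟨h1, h2, h3⟩, h4⟩ := (hsmall.and (h.eventually_lt_const hx)).exists
    obtain ⟨u, l, hu, -, hul⟩ := key η h1 h2 h3
    filter_upwards [hul, hu.eventually_lt_const h4] with t h5 h6
    exact h5.1.trans_lt h6

end

section

variable {ι : Type*} [Fintype ι]

lemma volume_Icc_cube_pos : 0 < volume (Set.Icc (-1 : ι → ℝ) 1) := by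
  rw [Real.volume_Icc_pi]
  exact pos_iff_ne_zero.mpr (Finset.prod_ne_zero_iff.mpr fun i _ => by simp)

/-- The asymptotics when the coordinates in `J` are constrained: integrating over the coordinates in
`J` with the others fixed gives a quotient that converges, and by dominated convergence its limit
can be integrated over the other coordinates. -/
lemma exists_tendsto_setIntegral_prodLeSet {φ w : (ι → ℝ) → ℝ} (hφ : Continuous φ)
    (hφ0 : ∀ a, 0 < φ a) (hw : Continuous w) (hw0 : ∀ a, 0 < w a) {J : Finset ι}
    (hJ : J.Nonempty) :
    ∃ C, 0 < C ∧ Tendsto (fun t => (∫ a in prodLeSet J w t, φ a) / logRate J.card t) (𝓝[>] 0)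
      (𝓝 C) := by
  classical
  have : Nonempty {i // i ∈ J} := hJ.to_subtype
  have hcard : Fintype.card {i // i ∈ J} = J.card := Fintype.card_coe J
  have hJ0 : 0 < J.card := hJ.card_pos
  obtain ⟨M, hM0, hM⟩ := exists_upper_bound_cube hw hw0
  obtain ⟨Φ, hΦ0, hΦ⟩ := exists_upper_bound_cube hφ hφ0
  let e := MeasurableEquiv.piEquivPiSubtypeProd (fun _ : ι => ℝ) (· ∈ J)
  have he : MeasurePreserving e := by
    convert volume_preserving_piEquivPiSubtypeProd (fun _ : ι => ℝ) (· ∈ J)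
  let glue : ({i // i ∈ J} → ℝ) → ({i // i ∉ J} → ℝ) → ι → ℝ :=
    fun x y i => if h : i ∈ J then x ⟨i, h⟩ else y ⟨i, h⟩
  have hglue : ∀ x y, e.symm (x, y) = glue x y := fun x y => rfl
  have hglue_cont : Continuous fun z : ({i // i ∈ J} → ℝ) × ({i // i ∉ J} → ℝ) =>
      glue z.1 z.2 := by
    refine continuous_pi fun i => ?_
    by_cases h : i ∈ J
    · simp only [glue, h, dite_true]
      fun_prop
    · simp only [glue, h, dite_false]
      fun_prop
  have hglue_left : ∀ y, Continuous fun x => glue x y := fun y =>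
    hglue_cont.comp (continuous_id.prodMk continuous_const)
  have hglue_right : ∀ x, Continuous fun y => glue x y := fun x =>
    hglue_cont.comp (continuous_const.prodMk continuous_id)
  have hglue_in : ∀ (x : {i // i ∈ J} → ℝ) y (i : {i // i ∈ J}), glue x y i = x i := fun x y i => by
    simp [glue]
  have hglue_out : ∀ x (y : {i // i ∉ J} → ℝ) (i : {i // i ∉ J}), glue x y i = y i :=
    fun x y i => by simp [glue, i.2]
  have hcube : ∀ x y, glue x y ∈ Set.Icc (-1 : ι → ℝ) 1 ↔
      x ∈ Set.Icc (-1) 1 ∧ y ∈ Set.Icc (-1) 1 := by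
    intro x y
    constructor
    · intro h
      refine ⟨⟨fun i => ?_, fun i => ?_⟩, ⟨fun i => ?_, fun i => ?_⟩⟩
      · rw [← hglue_in x y i]; exact h.1 i
      · rw [← hglue_in x y i]; exact h.2 i
      · rw [← hglue_out x y i]; exact h.1 i
      · rw [← hglue_out x y i]; exact h.2 i
    · rintro ⟨⟨h1, h2⟩, ⟨h3, h4⟩⟩
      refine ⟨fun i => ?_, fun i => ?_⟩ <;> by_cases h : i ∈ J <;> simp only [glue, h, dite_true,
        dite_false]
      · exact h1 ⟨i, h⟩
      · exact h3 ⟨i, h⟩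
      · exact h2 ⟨i, h⟩
      · exact h4 ⟨i, h⟩
  have hmem : ∀ t x y, glue x y ∈ prodLeSet J w t ↔
      y ∈ Set.Icc (-1) 1 ∧ x ∈ prodLeSet Finset.univ (fun x => w (glue x y)) t := by
    intro t x y
    have h1 : ∏ i ∈ J, |glue x y i| = ∏ i : {i // i ∈ J}, |x i| := by
      rw [← Finset.prod_coe_sort]
      exact Finset.prod_congr rfl fun i _ => by rw [hglue_in]
    simp only [prodLeSet, Set.mem_ofPred_eq, hcube, h1]
    tauto
  -- the inner integral, over the coordinates in `J`
  let I : ℝ → ({i // i ∉ J} → ℝ) → ℝ := fun t y =>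
    ∫ x in prodLeSet Finset.univ (fun x => w (glue x y)) t, φ (glue x y)
  have hint : ∀ t, Integrable (fun z => (prodLeSet J w t).indicator φ (e.symm z))
      ((volume : Measure ({i // i ∈ J} → ℝ)).prod (volume : Measure ({i // i ∉ J} → ℝ))) := by
    intro t
    have h := (integrable_indicator_iff (measurableSet_prodLeSet J hw t)).mpr
      (integrableOn_of_subset_cube hφ (prodLeSet_subset_Icc J w t))
    exact (he.symm.integrable_comp_emb e.symm.measurableEmbedding).mpr h
  have hinner : ∀ t y, ∫ x, (prodLeSet J w t).indicator φ (e.symm (x, y)) =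
      (Set.Icc (-1) 1).indicator (I t) y := by
    intro t y
    have hm : MeasurableSet (prodLeSet Finset.univ (fun x => w (glue x y)) t) :=
      measurableSet_prodLeSet _ (hw.comp (hglue_left y)) t
    by_cases hy : y ∈ Set.Icc (-1 : {i // i ∉ J} → ℝ) 1
    · rw [Set.indicator_of_mem hy]
      change _ = ∫ x in prodLeSet Finset.univ (fun x => w (glue x y)) t, φ (glue x y)
      rw [← integral_indicator hm]
      refine integral_congr_ae (Eventually.of_forall fun x => ?_)
      simp only [hglue, Set.indicator_apply, hmem, hy, true_and]
    · rw [Set.indicator_of_notMem hy]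
      simp only [hglue, Set.indicator_apply, hmem, hy, false_and, if_false, integral_zero]
  have hfubini : ∀ t, ∫ a in prodLeSet J w t, φ a = ∫ y in Set.Icc (-1) 1, I t y := by
    intro t
    rw [← integral_indicator (measurableSet_prodLeSet J hw t), ← he.symm.integral_comp',
      ← integral_indicator measurableSet_Icc]
    refine (integral_prod_symm _ (hint t)).trans ?_
    simp only [hinner]
  have hmeas : ∀ t, AEStronglyMeasurable (I t) (volume.restrict (Set.Icc (-1) 1)) := by
    intro t
    have h := (hint t).integral_prod_right
    simp only [hinner] at h
    exact ((integrable_indicator_iff measurableSet_Icc).mp h).aestronglyMeasurable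
  let c : ({i // i ∉ J} → ℝ) → ℝ := fun y => φ (glue 0 y) *
    (2 ^ J.card * (w (glue 0 y) / ((J.card - 1).factorial : ℝ)))
  have hc_cont : Continuous c := by
    have h1 := hφ.comp (hglue_right 0)
    have h2 := hw.comp (hglue_right 0)
    exact h1.mul (continuous_const.mul (h2.div_const _))
  have hc_pos : ∀ y, 0 < c y := fun y =>
    mul_pos (hφ0 _) (mul_pos (by positivity) (div_pos (hw0 _) (by positivity)))
  have hlim : ∀ y, Tendsto (fun t => I t y / logRate J.card t) (𝓝[>] 0) (𝓝 (c y)) := by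
    intro y
    have h := tendsto_setIntegral_prodLeSet_univ (hφ.comp (hglue_left y)) (fun x => hφ0 _)
      (hw.comp (hglue_left y)) (fun x => hw0 _)
    rw [hcard] at h
    exact h
  have hboxlim := tendsto_volume_prodLeBox_one (J := (Finset.univ : Finset {i // i ∈ J})) hJ0
    (by rw [Finset.card_univ, hcard]) hM0
  obtain ⟨B, hB⟩ : ∃ B, ∀ᶠ t in 𝓝[>] 0, volume.real (prodLeBox (1 : {i // i ∈ J} → ℝ)
      Finset.univ (M * t)) / logRate J.card t ≤ B :=
    ⟨_, hboxlim.eventually_le_const (lt_add_one _)⟩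
  refine ⟨∫ y in Set.Icc (-1) 1, c y, ?_, ?_⟩
  · rw [setIntegral_pos_iff_support_of_nonneg_ae
      (Eventually.of_forall fun y => (hc_pos y).le) (integrableOn_of_subset_cube hc_cont le_rfl)]
    rw [show Function.support c = Set.univ from Set.eq_univ_of_forall fun y => (hc_pos y).ne',
      Set.univ_inter]
    exact volume_Icc_cube_pos
  · simp only [hfubini, ← integral_div]
    refine tendsto_integral_filter_of_dominated_convergence (fun _ => Φ * B)
      (Eventually.of_forall fun t =>
        (continuous_id.div_const _).comp_aestronglyMeasurable (hmeas t)) ?_ ?_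
      (Eventually.of_forall hlim)
    · filter_upwards [hB, eventually_logRate_pos J.card] with t htB ht
      filter_upwards [ae_restrict_mem measurableSet_Icc] with y hy
      have hsub : prodLeSet Finset.univ (fun x => w (glue x y)) t ⊆
          prodLeBox 1 Finset.univ (M * t) :=
        prodLeSet_subset_prodLeBox _ ht.1.le fun x hx => hM _ ((hcube x y).mpr ⟨hx, hy⟩)
      have hnn : 0 ≤ I t y := integral_nonneg fun x => (hφ0 _).le
      rw [Real.norm_of_nonneg (div_nonneg hnn ht.2.le)]
      have h1 : I t y ≤ Φ * volume.real (prodLeBox (1 : {i // i ∈ J} → ℝ) Finset.univ (M * t)) :=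
        (setIntegral_le_mul_volume (hφ.comp (hglue_left y)) (prodLeSet_subset_Icc _ _ _)
          (measurableSet_prodLeSet _ (hw.comp (hglue_left y)) t) fun x hx =>
            hΦ _ ((hcube x y).mpr ⟨hx.1, hy⟩)).trans
        (mul_le_mul_of_nonneg_left (measureReal_mono hsub
          (volume_lt_top_of_subset_cube (prodLeBox_subset_Icc _ _)).ne) hΦ0.le)
      calc I t y / logRate J.card t ≤ Φ * volume.real (prodLeBox (1 : {i // i ∈ J} → ℝ)
            Finset.univ (M * t)) / logRate J.card t := div_le_div_of_nonneg_right h1 ht.2.le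
        _ = Φ * (volume.real (prodLeBox (1 : {i // i ∈ J} → ℝ) Finset.univ (M * t)) /
            logRate J.card t) := mul_div_assoc _ _ _
        _ ≤ Φ * B := mul_le_mul_of_nonneg_left htB hΦ0.le
    · exact integrableOn_const (hs := isCompact_Icc.measure_lt_top.ne)

end

/-! ### Finite unions -/

section

variable {ι : Type*} [Fintype ι]

/-- Two different products of at most `m` factors are rarely small at the same time. If both have
`m` factors, some coordinate `k` occurs in the second only. Where `|a k| ≤ δ`, the first condition
has `δ` times its volume; elsewhere, the second product is small with the factor `k` left out. -/
lemma tendsto_volume_inter_prodLeBox {J J' : Finset ι} (hne : J ≠ J') {m : ℕ} (hm : 0 < m)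
    (hJ : J.card ≤ m) (hJ' : J'.card ≤ m) {M : ℝ} (hM : 0 < M) :
    Tendsto (fun t => volume.real (prodLeBox 1 J (M * t) ∩ prodLeBox 1 J' (M * t)) / logRate m t)
      (𝓝[>] 0) (𝓝 0) := by
  classical
  have hnn : ∀ᶠ t in 𝓝[>] (0 : ℝ), 0 ≤
      volume.real (prodLeBox 1 J (M * t) ∩ prodLeBox 1 J' (M * t)) / logRate m t := by
    filter_upwards [eventually_logRate_pos m] with t ht using div_nonneg measureReal_nonneg ht.2.le
  have hsmall : ∀ K : Finset ι, K.card < m →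
      (∀ t, prodLeBox 1 J (M * t) ∩ prodLeBox 1 J' (M * t) ⊆ prodLeBox 1 K (M * t)) →
      Tendsto (fun t => volume.real (prodLeBox 1 J (M * t) ∩ prodLeBox 1 J' (M * t)) / logRate m t)
      (𝓝[>] 0) (𝓝 0) := by
    intro K hK hsub
    have h := tendsto_volume_prodLeBox_one (J := K) hm hK.le hM
    rw [if_neg hK.ne, mul_zero] at h
    refine tendsto_of_tendsto_of_tendsto_of_le_of_le' tendsto_const_nhds h hnn ?_
    filter_upwards [eventually_logRate_pos m] with t ht
    exact div_le_div_of_nonneg_right (measureReal_mono (hsub t)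
      (volume_lt_top_of_subset_cube (prodLeBox_subset_Icc _ _)).ne) ht.2.le
  rcases hJ.lt_or_eq with h1 | h1
  · exact hsmall J h1 fun t => Set.inter_subset_left
  rcases hJ'.lt_or_eq with h2 | h2
  · exact hsmall J' h2 fun t => Set.inter_subset_right
  obtain ⟨k, hk', hk⟩ : ∃ k ∈ J', k ∉ J := by
    by_contra! h
    exact hne (Finset.eq_of_subset_of_card_le h (by omega)).symm
  have hcard : (J'.erase k).card < m := by
    rw [Finset.card_erase_of_mem hk']
    omega
  refine tendsto_order.mpr ⟨fun x hx => hnn.mono fun t ht => hx.trans_le ht, fun x hx => ?_⟩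
  set C : ℝ := 2 ^ Fintype.card ι * (M / ((m - 1).factorial : ℝ)) with hC
  have hC0 : 0 < C := by positivity
  obtain ⟨δ, hδ0, hδ1, hδx⟩ : ∃ δ > 0, δ ≤ 1 ∧ δ * C < x := by
    refine ⟨min 1 (x / (2 * C)), by positivity, min_le_left _ _, ?_⟩
    have h : min 1 (x / (2 * C)) * C ≤ x / (2 * C) * C :=
      mul_le_mul_of_nonneg_right (min_le_right _ _) hC0.le
    have h' : x / (2 * C) * C = x / 2 := by field_simp
    linarith
  -- the box that is shorter by the factor `δ` in the direction `k`
  let c : ι → ℝ := Function.update 1 k δ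
  have hc0 : ∀ i, 0 ≤ c i := fun i => by
    by_cases h : i = k
    · subst h; simp [c, hδ0.le]
    · simp [c, h]
  have hcJ : ∀ i ∈ J, c i = 1 := fun i hi => by
    simp [c, Function.update_of_ne (ne_of_mem_of_not_mem hi hk)]
  have hprod : ∏ i, 2 * c i = δ * 2 ^ Fintype.card ι := by
    rw [Finset.prod_mul_distrib, Finset.prod_const, Finset.card_univ,
      Finset.prod_update_of_mem (Finset.mem_univ k)]
    simp [mul_comm]
  have l1 := tendsto_volume_prodLeBox hc0 hcJ hm hJ hM
  have l2 := tendsto_volume_prodLeBox_one (J := J'.erase k) hm hcard.le (div_pos hM hδ0)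
  rw [if_pos h1, hprod, mul_assoc, ← hC] at l1
  rw [if_neg hcard.ne, mul_zero] at l2
  have l3 := l1.add l2
  rw [add_zero] at l3
  filter_upwards [l3.eventually_lt_const hδx, eventually_logRate_pos m] with t ht hpos
  refine lt_of_le_of_lt ?_ ht
  rw [← add_div]
  refine div_le_div_of_nonneg_right ?_ hpos.2.le
  have hcube : prodLeBox c J (M * t) ⊆ Set.Icc (-1) 1 := by
    have hc1 : c ≤ 1 := fun i => by
      by_cases h : i = k
      · subst h; simp [c, hδ1]
      · simp [c, h]
    exact fun a ha => ⟨(neg_le_neg hc1).trans ha.1.1, ha.1.2.trans hc1⟩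
  refine (measureReal_mono (fun a ha => ?_) (volume_lt_top_of_subset_cube
    (Set.union_subset hcube (prodLeBox_subset_Icc _ _))).ne).trans (measureReal_union_le _ _)
  obtain ⟨⟨ha, haJ⟩, -, haJ'⟩ := ha
  by_cases hak : |a k| ≤ δ
  · left
    have hak' := abs_le.mp hak
    refine ⟨⟨fun i => ?_, fun i => ?_⟩, haJ⟩ <;> by_cases h : i = k
    · subst h; simpa [c] using hak'.1
    · simpa [c, h] using ha.1 i
    · subst h; simpa [c] using hak'.2
    · simpa [c, h] using ha.2 i
  · right
    refine ⟨ha, ?_⟩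
    rw [div_mul_eq_mul_div, le_div_iff₀ hδ0]
    refine le_trans ?_ haJ'
    rw [← Finset.prod_erase_mul _ _ hk']
    exact mul_le_mul_of_nonneg_left (not_le.mp hak).le
      (Finset.prod_nonneg fun _ _ => abs_nonneg _)

lemma tendsto_setIntegral_of_tendsto_volume {φ : (ι → ℝ) → ℝ} (hφ : Continuous φ)
    (hφ0 : ∀ a, 0 < φ a) {A B : ℝ → Set (ι → ℝ)} {m : ℕ} (hA : ∀ t, MeasurableSet (A t))
    (hB : ∀ t, B t ⊆ Set.Icc (-1) 1) (hAB : ∀ t, 0 < t → A t ⊆ B t)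
    (hlim : Tendsto (fun t => volume.real (B t) / logRate m t) (𝓝[>] 0) (𝓝 0)) :
    Tendsto (fun t => (∫ a in A t, φ a) / logRate m t) (𝓝[>] 0) (𝓝 0) := by
  obtain ⟨Φ, hΦ0, hΦ⟩ := exists_upper_bound_cube hφ hφ0
  have h := hlim.const_mul Φ
  rw [mul_zero] at h
  refine tendsto_of_tendsto_of_tendsto_of_le_of_le' tendsto_const_nhds h ?_ ?_
  · filter_upwards [eventually_logRate_pos m] with t ht
    exact div_nonneg (integral_nonneg fun a => (hφ0 a).le) ht.2.le
  · filter_upwards [eventually_logRate_pos m] with t ht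
    rw [← mul_div_assoc]
    refine div_le_div_of_nonneg_right ?_ ht.2.le
    exact (setIntegral_le_mul_volume hφ ((hAB t ht.1).trans (hB t)) (hA t)
      fun a ha => hΦ a (hB t (hAB t ht.1 ha))).trans (mul_le_mul_of_nonneg_left
        (measureReal_mono (hAB t ht.1) (volume_lt_top_of_subset_cube (hB t)).ne) hΦ0.le)

/-- A finite union of conditions on products of at most `m ≥ 1` coordinates, one condition for each
set of coordinates: the conditions with fewer factors and the intersections of two conditions are
negligible, so the constants of the conditions with `m` factors add up. -/
lemma exists_tendsto_setIntegral_biUnion {φ : (ι → ℝ) → ℝ} (hφ : Continuous φ)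
    (hφ0 : ∀ a, 0 < φ a) {W : Finset ι → (ι → ℝ) → ℝ} (hW : ∀ J, Continuous (W J))
    (hW0 : ∀ J a, 0 < W J a) {m : ℕ} (hm : 0 < m) (s : Finset (Finset ι)) :
    (∀ J ∈ s, J.card ≤ m) → ∃ C, 0 ≤ C ∧ ((∃ J ∈ s, J.card = m) → 0 < C) ∧
      Tendsto (fun t => (∫ a in ⋃ J ∈ s, prodLeSet J (W J) t, φ a) / logRate m t) (𝓝[>] 0)
        (𝓝 C) := by
  classical
  induction s using Finset.induction_on with
  | empty => exact fun _ => ⟨0, le_rfl, by simp, by simp⟩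
  | insert J s hJs ih =>
    intro hcard
    obtain ⟨C, hC0, hCpos, hC⟩ := ih fun K hK => hcard K (Finset.mem_insert_of_mem hK)
    have hJm := hcard J (Finset.mem_insert_self _ _)
    obtain ⟨D, hD0, hDpos, hD⟩ : ∃ D, 0 ≤ D ∧ (J.card = m → 0 < D) ∧
        Tendsto (fun t => (∫ a in prodLeSet J (W J) t, φ a) / logRate m t) (𝓝[>] 0) (𝓝 D) := by
      rcases hJm.eq_or_lt with h | h
      · obtain ⟨D, hD0, hD⟩ := exists_tendsto_setIntegral_prodLeSet hφ hφ0 (hW J) (hW0 J)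
          (Finset.card_pos.mp (h ▸ hm))
        exact ⟨D, hD0.le, fun _ => hD0, h ▸ hD⟩
      · refine ⟨0, le_rfl, fun h' => absurd h' h.ne, ?_⟩
        obtain ⟨M, hM0, hM⟩ := exists_upper_bound_cube (hW J) (hW0 J)
        have hlim := tendsto_volume_prodLeBox_one (J := J) hm hJm hM0
        rw [if_neg h.ne, mul_zero] at hlim
        exact tendsto_setIntegral_of_tendsto_volume hφ hφ0
          (fun t => measurableSet_prodLeSet J (hW J) t) (fun t => prodLeBox_subset_Icc _ _)
          (fun t ht => prodLeSet_subset_prodLeBox J ht.le hM) hlim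
    have hUm : ∀ t, MeasurableSet (⋃ K ∈ s, prodLeSet K (W K) t) := fun t =>
      Finset.measurableSet_biUnion _ fun K _ => measurableSet_prodLeSet K (hW K) t
    have hUc : ∀ t, ⋃ K ∈ s, prodLeSet K (W K) t ⊆ Set.Icc (-1) 1 := fun t =>
      Set.iUnion₂_subset fun K _ => prodLeSet_subset_Icc _ _ _
    have hinter : Tendsto (fun t => (∫ a in prodLeSet J (W J) t ∩ ⋃ K ∈ s, prodLeSet K (W K) t,
        φ a) / logRate m t) (𝓝[>] 0) (𝓝 0) := by
      choose M hM0 hM using fun K => exists_upper_bound_cube (hW K) (hW0 K)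
      -- one bound for all the weights involved
      let N : ℝ := M J + ∑ K ∈ s, M K
      have hN0 : 0 < N := add_pos_of_pos_of_nonneg (hM0 J) (Finset.sum_nonneg fun K _ => (hM0 K).le)
      have hNJ : ∀ a ∈ Set.Icc (-1 : ι → ℝ) 1, W J a ≤ N := fun a ha =>
        (hM J a ha).trans (le_add_of_nonneg_right (Finset.sum_nonneg fun K _ => (hM0 K).le))
      have hNK : ∀ K ∈ s, ∀ a ∈ Set.Icc (-1 : ι → ℝ) 1, W K a ≤ N := fun K hK a ha =>
        (hM K a ha).trans ((Finset.single_le_sum (f := M) (fun L _ => (hM0 L).le) hK).trans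
          (le_add_of_nonneg_left (hM0 J).le))
      have hBc : ∀ t, ⋃ K ∈ s, (prodLeBox 1 J (N * t) ∩ prodLeBox 1 K (N * t)) ⊆
          Set.Icc (-1 : ι → ℝ) 1 := fun t =>
        Set.iUnion₂_subset fun K _ => Set.inter_subset_left.trans (prodLeBox_subset_Icc _ _)
      refine tendsto_setIntegral_of_tendsto_volume hφ hφ0
        (B := fun t => ⋃ K ∈ s, (prodLeBox 1 J (N * t) ∩ prodLeBox 1 K (N * t)))
        (fun t => (measurableSet_prodLeSet J (hW J) t).inter (hUm t)) hBc (fun t ht => ?_) ?_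
      · rintro a ⟨haJ, haU⟩
        obtain ⟨K, hK, haK⟩ := Set.mem_iUnion₂.mp haU
        exact Set.mem_iUnion₂.mpr ⟨K, hK, prodLeSet_subset_prodLeBox J ht.le hNJ haJ,
          prodLeSet_subset_prodLeBox K ht.le (hNK K hK) haK⟩
      · have hsum : Tendsto (fun t => ∑ K ∈ s, volume.real (prodLeBox 1 J (N * t) ∩
            prodLeBox 1 K (N * t)) / logRate m t) (𝓝[>] 0) (𝓝 (∑ _K ∈ s, 0)) :=
          tendsto_finsetSum _ fun K hK => tendsto_volume_inter_prodLeBox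
            (by rintro rfl; exact hJs hK) hm hJm (hcard K (Finset.mem_insert_of_mem hK)) hN0
        rw [Finset.sum_const_zero] at hsum
        refine tendsto_of_tendsto_of_tendsto_of_le_of_le' tendsto_const_nhds hsum ?_ ?_
        · filter_upwards [eventually_logRate_pos m] with t ht
          exact div_nonneg measureReal_nonneg ht.2.le
        · filter_upwards [eventually_logRate_pos m] with t ht
          rw [← Finset.sum_div]
          exact div_le_div_of_nonneg_right (measureReal_biUnion_finset_le _ _) ht.2.le
    refine ⟨D + C, add_nonneg hD0 hC0, ?_, ?_⟩
    · rintro ⟨K, hK, hKm⟩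
      rcases Finset.mem_insert.mp hK with rfl | hK
      · exact add_pos_of_pos_of_nonneg (hDpos hKm) hC0
      · exact add_pos_of_nonneg_of_pos hD0 (hCpos ⟨K, hK, hKm⟩)
    · have h := (hD.add hC).sub hinter
      rw [sub_zero] at h
      refine h.congr fun t => ?_
      have hJi := integrableOn_of_subset_cube hφ (prodLeSet_subset_Icc J (W J) t)
      have hUi := integrableOn_of_subset_cube hφ (hUc t)
      have e1 := integral_inter_add_sdiff (hUm t) hJi
      have e2 : ∫ a in (prodLeSet J (W J) t \ ⋃ K ∈ s, prodLeSet K (W K) t) ∪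
          ⋃ K ∈ s, prodLeSet K (W K) t, φ a = _ :=
        setIntegral_union disjoint_sdiff_self_left (hUm t) (hJi.mono_set Set.sdiff_subset) hUi
      rw [Set.sdiff_union_self] at e2
      rw [Finset.set_biUnion_insert, e2, ← e1, ← add_div, ← sub_div]
      congr 1
      ring

/-- The same for conditions indexed by a finite type, where several conditions may concern the same
coordinates: these are merged into one by taking the largest weight. -/
lemma exists_tendsto_setIntegral_iUnion {T : Type*} [Finite T] {φ : (ι → ℝ) → ℝ}
    (hφ : Continuous φ) (hφ0 : ∀ a, 0 < φ a) (J : T → Finset ι) {w : T → (ι → ℝ) → ℝ}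
    (hw : ∀ α, Continuous (w α)) (hw0 : ∀ α a, 0 < w α a) {m : ℕ} (hm : 0 < m)
    (hJ : ∀ α, (J α).card ≤ m) (hex : ∃ α, (J α).card = m) :
    ∃ C, 0 < C ∧ Tendsto (fun t => (∫ a in ⋃ α, prodLeSet (J α) (w α) t, φ a) / logRate m t)
      (𝓝[>] 0) (𝓝 C) := by
  classical
  have := Fintype.ofFinite T
  let fiber : Finset ι → Finset T := fun K => Finset.univ.filter fun α => J α = K
  let W : Finset ι → (ι → ℝ) → ℝ := fun K a =>
    if h : (fiber K).Nonempty then (fiber K).sup' h fun α => w α a else 1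
  have hW : ∀ K, Continuous (W K) := by
    intro K
    by_cases h : (fiber K).Nonempty
    · simp only [W, h, dite_true]
      exact Continuous.finset_sup'_apply h fun α _ => hw α
    · simp only [W, h, dite_false]
      exact continuous_const
  have hW0 : ∀ K a, 0 < W K a := by
    intro K a
    by_cases h : (fiber K).Nonempty
    · simp only [W, h, dite_true]
      obtain ⟨α, hα⟩ := h
      exact (hw0 α a).trans_le (Finset.le_sup' (fun α => w α a) hα)
    · simp only [W, h, dite_false]
      exact one_pos
  obtain ⟨C, -, hC0, hC⟩ := exists_tendsto_setIntegral_biUnion hφ hφ0 hW hW0 hm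
    (Finset.univ.image J) (by simpa using hJ)
  refine ⟨C, hC0 (by simpa using hex), hC.congr' ?_⟩
  filter_upwards [self_mem_nhdsWithin] with t ht
  have ht : 0 < t := ht
  congr 3
  ext a
  simp only [Set.mem_iUnion, prodLeSet, Set.mem_ofPred_eq, Finset.mem_image, Finset.mem_univ,
    true_and, exists_prop, exists_exists_eq_and]
  constructor
  · rintro ⟨α, ha, hle⟩
    have hne : (fiber (J α)).Nonempty := ⟨α, by simp [fiber]⟩
    simp only [W, hne, dite_true] at hle
    obtain ⟨β, hβ, hsup⟩ := Finset.exists_mem_eq_sup' hne fun α => w α a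
    refine ⟨β, ha, ?_⟩
    rw [(Finset.mem_filter.mp hβ).2, ← hsup]
    exact hle
  · rintro ⟨α, ha, hle⟩
    have hmem : α ∈ fiber (J α) := by simp [fiber]
    have hne : (fiber (J α)).Nonempty := ⟨α, hmem⟩
    refine ⟨α, ha, hle.trans (mul_le_mul_of_nonneg_left ?_ ht.le)⟩
    simp only [W, hne, dite_true]
    exact Finset.le_sup' (fun α => w α a) hmem

end

/-! ### The volume of the unfaithful parameters -/

namespace OrderedDAG

variable {p : ℕ} {G : OrderedDAG p}

/-- A prior agrees on the cube with a function that is continuous and positive everywhere, namely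
its composition with the projection onto the cube. -/
lemma IsPrior.exists_continuous_pos {φ : G.Param → ℝ} (hφ : G.IsPrior φ) :
    ∃ ψ : G.Param → ℝ, Continuous ψ ∧ (∀ a, 0 < ψ a) ∧ ∀ a ∈ G.cube, ψ a = φ a := by
  let proj : G.Param → G.Param := fun a e => max (-1) (min 1 (a e))
  have hproj : ∀ a, proj a ∈ G.cube := fun a =>
    ⟨fun e => le_max_left _ _, fun e => max_le (by simp) (min_le_left _ _)⟩
  have hcont : Continuous proj := by fun_prop
  refine ⟨φ ∘ proj, hφ.analytic.continuousOn.comp_continuous hcont hproj,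
    fun a => hφ.pos _ (hproj a), fun a ha => ?_⟩
  have : proj a = a := funext fun e => by
    simp only [proj, min_eq_right (show a e ≤ 1 from ha.2 e),
      max_eq_right (show -1 ≤ a e from ha.1 e)]
  simp [this]

/-- Unfaithfulness as a union of conditions on products: the asymptotics of the volume for a graph
without colliders in which the partial correlation of two d-connected nodes is, up to a positive
continuous factor, the product of the weights of certain edges. -/
lemma IsForest.exists_isEquivalent_unfaithfulVolume (hG : G.IsForest)
    (seg : Fin p → Fin p → Finset ↥G.edges)
    (hsep : ∀ i j S, i < j → i ∉ S → j ∉ S → G.DSeparated i j S → ∀ a, G.corr a i j S = 0)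
    (hcon : ∀ i j S, i < j → i ∉ S → j ∉ S → ¬ G.DSeparated i j S →
      ∃ h : G.Param → ℝ, Continuous h ∧ (∀ a, 0 < h a) ∧
        ∀ a, |G.corr a i j S| = (∏ e ∈ seg i j, |a e|) * h a)
    {m : ℕ} (hm : 0 < m) (hle : ∀ i j, i < j → (seg i j).card ≤ m)
    (hex : ∃ i j, i < j ∧ ¬ G.DSeparated i j ∅ ∧ (seg i j).card = m)
    {φ : G.Param → ℝ} (hφ : G.IsPrior φ) :
    ∃ C : ℝ, 0 < C ∧ (fun t : ℝ => G.unfaithfulVolume φ t) ~[𝓝[>] 0]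
      (fun t : ℝ => C * (t * (-Real.log t) ^ (m - 1))) := by
  classical
  let T := {x : Fin p × Fin p × Finset (Fin p) // x.1 < x.2.1 ∧ x.1 ∉ x.2.2 ∧ x.2.1 ∉ x.2.2 ∧
    ¬ G.DSeparated x.1 x.2.1 x.2.2}
  have hT : ∀ α : T, ∃ h : G.Param → ℝ, Continuous h ∧ (∀ a, 0 < h a) ∧
      ∀ a, |G.corr a α.1.1 α.1.2.1 α.1.2.2| = (∏ e ∈ seg α.1.1 α.1.2.1, |a e|) * h a :=
    fun α => hcon _ _ _ α.2.1 α.2.2.1 α.2.2.2.1 α.2.2.2.2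
  choose h hc hpos hcorr using hT
  obtain ⟨ψ, hψ, hψ0, hψφ⟩ := hφ.exists_continuous_pos
  obtain ⟨C, hC0, hC⟩ := exists_tendsto_setIntegral_iUnion hψ hψ0
    (fun α : T => seg α.1.1 α.1.2.1) (w := fun α a => (h α a)⁻¹)
    (fun α => (hc α).inv₀ fun a => (hpos α a).ne') (fun α a => inv_pos.mpr (hpos α a)) hm
    (fun α => hle _ _ α.2.1)
    (by
      obtain ⟨i, j, hij, hd, hcard⟩ := hex
      exact ⟨⟨(i, j, ∅), hij, by simp, by simp, hd⟩, hcard⟩)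
  refine ⟨C, hC0, ?_⟩
  have hvol : ∀ t : ℝ, 0 < t → G.unfaithfulVolume φ t =
      ∫ a in ⋃ α : T, prodLeSet (seg α.1.1 α.1.2.1) (fun a => (h α a)⁻¹) t, ψ a := by
    intro t ht
    have hset : {a | a ∈ G.cube ∧ ¬ G.StrongFaithful t a} =
        ⋃ α : T, prodLeSet (seg α.1.1 α.1.2.1) (fun a => (h α a)⁻¹) t := by
      have hiff : ∀ (α : T) a, ∏ e ∈ seg α.1.1 α.1.2.1, |a e| ≤ t * (h α a)⁻¹ ↔
          |G.corr a α.1.1 α.1.2.1 α.1.2.2| ≤ t := fun α a => by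
        rw [hcorr, ← div_eq_mul_inv, le_div_iff₀ (hpos α a)]
      ext a
      simp only [Set.mem_iUnion, prodLeSet, Set.mem_ofPred_eq, hiff, exists_and_left, cube]
      refine and_congr_right fun _ => ⟨fun hn => ?_, ?_⟩
      · simp only [StrongFaithful, not_forall] at hn
        obtain ⟨S, i, j, hi, hj, hij, hn⟩ := hn
        have key : ∀ i j, i < j → i ∉ S → j ∉ S → ¬ (|G.corr a i j S| ≤ t ↔ G.DSeparated i j S) →
            ∃ α : T, |G.corr a α.1.1 α.1.2.1 α.1.2.2| ≤ t := by
          intro i j hij hi hj hn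
          by_cases hd : G.DSeparated i j S
          · exact absurd (iff_of_true (by simp [hsep i j S hij hi hj hd a, ht.le]) hd) hn
          · refine ⟨⟨(i, j, S), hij, hi, hj, hd⟩, ?_⟩
            by_contra hc
            exact hn (iff_of_false hc hd)
        rcases lt_or_gt_of_ne hij with hlt | hlt
        · exact key i j hlt hi hj hn
        · refine key j i hlt hj hi ?_
          rwa [corr_comm, hG.dSeparated_comm]
      · rintro ⟨α, hα⟩ hS
        exact α.2.2.2.2 ((hS _ _ _ α.2.2.1 α.2.2.2.1 α.2.1.ne).mp hα)
    rw [unfaithfulVolume, hset]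
    refine setIntegral_congr_fun (MeasurableSet.iUnion fun α =>
      measurableSet_prodLeSet _ ((hc α).inv₀ fun a => (hpos α a).ne') t) fun a ha => ?_
    obtain ⟨α, hα⟩ := Set.mem_iUnion.mp ha
    exact (hψφ a hα.1).symm
  refine isEquivalent_of_tendsto_one ?_
  have h1 := hC.div_const C
  rw [div_self hC0.ne'] at h1
  refine h1.congr' ?_
  filter_upwards [eventually_logRate_pos m] with t ht
  rw [Pi.div_apply, hvol t ht.1, div_div, mul_comm (logRate m t)]
  rfl

end OrderedDAG

theorem mainTheorem5 :
    (∀ p : ℕ, 2 ≤ p → ∀ φ : (chainDAG p).Param → ℝ, (chainDAG p).IsPrior φ →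
      ∃ C : ℝ, 0 < C ∧
        (fun t : ℝ => (chainDAG p).unfaithfulVolume φ t) ~[𝓝[>] 0]
          (fun t : ℝ => C * (t * (-Real.log t) ^ (p - 2)))) ∧
    (∀ p : ℕ, 3 ≤ p → ∀ φ : (starDAG p).Param → ℝ, (starDAG p).IsPrior φ →
      ∃ C : ℝ, 0 < C ∧
        (fun t : ℝ => (starDAG p).unfaithfulVolume φ t) ~[𝓝[>] 0]
          (fun t : ℝ => C * (t * (-Real.log t)))) := by
  constructor
  · intro p hp φ hφ
    refine isForest_chainDAG.exists_isEquivalent_unfaithfulVolume (m := p - 1) chainSegment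
      ?_ ?_ (by omega) ?_ ?_ hφ
    · intro i j S hij hi hj hd a
      obtain ⟨s, hs, his, hsj⟩ := (dSeparated_chainDAG hij hi hj).mp hd
      exact corr_chainDAG_eq_zero hs his hsj a
    · intro i j S hij hi hj hd
      exact exists_abs_corr_chainDAG hij fun s hs hsij =>
        hd ((dSeparated_chainDAG hij hi hj).mpr ⟨s, hs, hsij⟩)
    · intro i j _
      rw [← card_edges_chainDAG]
      exact Finset.card_le_univ _
    · have h0 : (⟨0, by omega⟩ : Fin p) < ⟨p - 1, by omega⟩ := Fin.lt_def.mpr (by simp; omega)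
      refine ⟨_, _, h0, ?_, ?_⟩
      · simp [dSeparated_chainDAG h0]
      · rw [chainSegment_eq_univ rfl (by simp; omega), Finset.card_univ, card_edges_chainDAG]
  · intro p hp φ hφ
    have h := isForest_starDAG.exists_isEquivalent_unfaithfulVolume (m := 2) starSegment
      (fun i j S hij hi hj hd a => corr_starDAG_eq_zero (o := ⟨0, by omega⟩) rfl hij hi
        ((dSeparated_starDAG rfl hij hi hj).mp hd) a)
      (fun i j S hij hi hj hd => exists_abs_corr_starDAG (o := ⟨0, by omega⟩) rfl hij fun ho =>
        hd ((dSeparated_starDAG rfl hij hi hj).mpr ho))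
      two_pos (fun i j hij => card_starSegment_le (o := ⟨0, by omega⟩) rfl hij)
      (by
        have h12 : (⟨1, by omega⟩ : Fin p) < ⟨2, by omega⟩ := Fin.lt_def.mpr (by simp)
        refine ⟨_, _, h12, ?_, card_starSegment (o := ⟨0, by omega⟩) rfl (by simp) h12⟩
        simp [dSeparated_starDAG (o := ⟨0, by omega⟩) rfl h12])
      hφ
    simpa using h
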